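/- Setting. Let $(\Omega,\Sigma,\lambda)$ be a finite measure space. For each $\omega\in\Omega$ let $\nabla_\omega$ be a complete Boolean algebra with a strictly positive countably additive real-valued measure $\mu_\omega$, and put $\rho_\omega(e,g)=\mu_\omega(e\vartriangle g)$. Let $(\nabla,L)$ be a measurable bundle of Boolean algebras over $\Omega$: $L$ is a nonempty set of sections $e:\omega\mapsto e(\omega)\in\nabla_\omega$, closed under $e\mapsto e^\perp$ and $(e_1,e_2)\mapsto e_1\vee e_2$ (taken pointwise), such that $\omega\mapsto\rho_\omega(e_1(\omega),e_2(\omega))$ is $\lambda$-measurable for all $e_1,e_2\in L$, and $\{e(\omega):e\in L\}$ is dense in $(\nabla_\omega,\rho_\omega)$ for every $\omega$. (Sections need only be defined almost everywhere; they may be extended arbitrarily.) A step section is one that equals $u_i\in L$ on $A_i$ for a finite measurable partition $(A_i)$ of $\Omega$. A section $e$ is measurable, $e\in M(\Omega,\nabla)$, if there are step sections $s_n$ with $\rho_\omega(s_n(\omega),e(\omega))\to 0$ for a.e. $\omega$. Let $\hat\nabla$ be the Boolean algebra of classes $\hat e$ of measurable sections modulo equality a.e., and let $\hat\mu(\hat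 e)$ be the class of $\omega\mapsto\mu_\omega(e(\omega))$. For a Boolean algebra $B$ with Stone space $Q(B)$ let $C_\infty(Q(B))$ be the set of continuous functions $Q(B)\to[-\infty,\infty]$ that are finite on a dense set, with the pointwise order. Put $L_0(\hat\nabla,\hat\mu)=C_\infty(Q(\hat\nabla))$ and $L_0(\nabla_\omega,\mu_\omega)=C_\infty(Q(\nabla_\omega))$, the latter with the metric $\int\frac{|a-b|}{1+|a-b|}\,d\mu_\omega$. A section $f(\omega)\in L_0(\nabla_\omega,\mu_\omega)$ is measurable if it is an a.e. limit, in these metrics, of step sections built from the sections $\sum_{i=1}^n\alpha_ie_i$ with $\alpha_i\in\mathbb R$, $e_i\in M(\Omega,\nabla)$. For $t\in\mathbb R$ write $[f>t]$ for the supremum in $B$ of all $c\in B$ such that $f>t$ on the clopen set of $c$. An element $\hat f\in L_0(\hat\nabla,\hat\mu)$ is identified with a measurable section $\{f(\omega)\}$ if for every $t\in\mathbb R$ the element $[\hat f>t]$ of $\hat\nabla$ is the class of a measurable section that is equal to $[f(\omega)>t]$ for a.e. $\omega$. A net $(x_i)_{i\in I}$ in a partially ordered set $(o)$-converges to $x$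 if there are nets $(l_i)_{i\in I}$, $(r_i)_{i\in I}$ with $l_i\le x_i\le r_i$ for all $i$, $l_i\uparrow x$ and $r_i\downarrow x$. The set $\mathbb N^d$ of multi-indices carries the coordinatewise order. Statement. Every $\hat f\in L_0(\hat\nabla,\hat\mu)$ is identified with some measurable section $\{f(\omega)\}$. Let $\hat f_{\mathbf n}\in L_0(\hat\nabla,\hat\mu)$, $\mathbf n\in\mathbb N^d$, be identified with the sections $\{f_{\mathbf n}(\omega)\}$. (i) If $\hat f_{\mathbf n}\xrightarrow{(o)}\hat f$ for some $\hat f\in L_0(\hat\nabla,\hat\mu)$, identified with $\{f(\omega)\}$, then $f_{\mathbf n}(\omega)\xrightarrow{(o)}f(\omega)$ in $L_0(\nabla_\omega,\mu_\omega)$ for a.e. $\omega\in\Omega$. (ii) Conversely, if $g(\omega)\in L_0(\nabla_\omega,\mu_\omega)$ and $f_{\mathbf n}(\omega)\xrightarrow{(o)}g(\omega)$ for a.e. $\omega\in\Omega$, then $\hat g\in L_0(\hat\nabla,\hat\mu)$, that is, $\{g(\omega)\}$ is a measurable section and some $\hat g\in L_0(\hat\nabla,\hat\mu)$ is identified with it,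 and $\hat f_{\mathbf n}\xrightarrow{(o)}\hat g$ in $L_0(\hat\nabla,\hat\mu)$. -/

import Mathlib

open MeasureTheory Filter Topology

universe u v w

/-! ## The Stone space `Q(B)` of a Boolean algebra and the lattice `C_∞(Q(B))` -/

/-- The Stone space `Q(B)` of a Boolean algebra `B`: the space of all ultrafilters of `B`. -/
@[ext]
structure StoneSpace (B : Type v) [BooleanAlgebra B] where
  /-- The ultrafilter, as a set of elements of `B`. -/
  carrier : Set B
  top_mem : ⊤ ∈ carrier
  mem_of_le : ∀ a b, a ∈ carrier → a ≤ b → b ∈ carrier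
  inf_mem : ∀ a b, a ∈ carrier → b ∈ carrier → a ⊓ b ∈ carrier
  compl_mem_iff : ∀ a, aᶜ ∈ carrier ↔ a ∉ carrier

namespace StoneSpace

variable {B : Type v} [BooleanAlgebra B]

/-- The subset of `Q(B)` that corresponds to `b : B`. -/
def basic (b : B) : Set (StoneSpace B) := {x | b ∈ x.carrier}

/-- The Stone topology, generated by the sets that correspond to the elements of `B`. -/
instance instTopologicalSpace : TopologicalSpace (StoneSpace B) :=
  TopologicalSpace.generateFrom (Set.range basic)

theorem compl_basic (b : B) : (basic b)ᶜ = basic bᶜ :=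
  Set.ext fun x => (x.compl_mem_iff b).symm

theorem isClopen_basic (b : B) : IsClopen (basic b) :=
  ⟨⟨by rw [compl_basic]; exact TopologicalSpace.isOpen_generateFrom_of_mem ⟨_, rfl⟩⟩,
    TopologicalSpace.isOpen_generateFrom_of_mem ⟨_, rfl⟩⟩

end StoneSpace

/-- `C_∞(Q(B))`: the continuous functions from `Q(B)` to the extended reals that are finite on a
dense subset. -/
noncomputable def L0 (B : Type v) [BooleanAlgebra B] : Type v :=
  {f : C(StoneSpace B, EReal) // Dense {x | f x ≠ ⊥ ∧ f x ≠ ⊤}}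

namespace L0

variable {B : Type v}

section Order

variable [BooleanAlgebra B]

/-- The value at a point of the Stone space. -/
noncomputable def val (f : L0 B) (x : StoneSpace B) : EReal := f.1 x

/-- The pointwise order. -/
noncomputable instance instPartialOrder : PartialOrder (L0 B) :=
  PartialOrder.lift val fun _ _ h => Subtype.ext (ContinuousMap.ext fun x => congrFun h x)

/-- `b` is the element `[f > t]` of the Boolean algebra: the supremum of all `c` such that
`f > t` on the clopen set of `c`. -/
def IsSuperlevel (f : L0 B) (t : ℝ) (b : B) : Prop :=
  IsLUB {c : B | ∀ x ∈ StoneSpace.basic c, (t : EReal) < f.val x} b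

open Classical in
/-- The simple element `∑ i, α i • e i`, that is, the function `∑ i, α i • 1_{e i}`. -/
noncomputable def simple {n : ℕ} (α : Fin n → ℝ) (e : Fin n → B) : L0 B :=
  ⟨⟨fun x => ((∑ i, if x ∈ StoneSpace.basic (e i) then α i else 0 : ℝ) : EReal), by
    refine continuous_coe_real_ereal.comp (continuous_finsetSum _ fun i _ => ?_)
    refine continuous_const.if (fun a ha => ?_) continuous_const
    rw [show {x | x ∈ StoneSpace.basic (e i)} = StoneSpace.basic (e i) from rfl,
      (StoneSpace.isClopen_basic (e i)).frontier_eq] at ha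
    exact ha.elim⟩, by
    convert dense_univ
    ext x
    simp⟩

end Order

/-- For a measure `m` on a complete Boolean algebra, `∫ |a - b| / (1 + |a - b|) dm`. The integral of
a function `h` with values in `[0, 1)` is written as `∫₀¹ m [h > t] dt`, where `[h > t]` is the
supremum of all `c` such that on the clopen set of `c` the elements `a` and `b` are finite
and `h > t`. -/
noncomputable def metric [CompleteBooleanAlgebra B] (m : B → ℝ) (a b : L0 B) : ℝ :=
  ∫ t in (0 : ℝ)..1, m (sSup {c : B | ∀ x ∈ StoneSpace.basic c,
    (a.val x ≠ ⊥ ∧ a.val x ≠ ⊤) ∧ (b.val x ≠ ⊥ ∧ b.val x ≠ ⊤) ∧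
      t < |(a.val x).toReal - (b.val x).toReal| / (1 + |(a.val x).toReal - (b.val x).toReal|)})

end L0

/-- `(o)`-convergence of a net `f` to `a`: there are nets `l` and `r`, with the same index set,
with `l i ≤ f i ≤ r i` for all `i`, `l ↑ a` and `r ↓ a`. -/
def OConverges {ι : Type w} [Preorder ι] {E : Type v} [PartialOrder E] (f : ι → E) (a : E) :
    Prop :=
  ∃ l r : ι → E, Monotone l ∧ IsLUB (Set.range l) a ∧ Antitone r ∧ IsGLB (Set.range r) a ∧
    ∀ i, l i ≤ f i ∧ f i ≤ r i

/-! ## Strictly positive measures, and sections of bundles of metric spaces -/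

/-- `m` is a strictly positive (finite, countably additive) real-valued measure on `B`. -/
structure IsStrictlyPositiveMeasure {B : Type v} [CompleteBooleanAlgebra B] (m : B → ℝ) :
    Prop where
  nonneg : ∀ a, 0 ≤ m a
  add : ∀ a b, Disjoint a b → m (a ⊔ b) = m a + m b
  tendsto_zero : ∀ e : ℕ → B, Antitone e → ⨅ n, e n = ⊥ → Tendsto (fun n => m (e n)) atTop (𝓝 0)
  eq_bot : ∀ a, m a = 0 → a = ⊥

/-- A step section: `s ω = u i ω` for `ω ∈ A i`, with a finite measurable partition
`A i` (the level sets of `φ`) and sections `u i ∈ L`. -/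
def IsStepSection {Ω : Type u} [MeasurableSpace Ω] {X : Ω → Type v} (L : Set (∀ ω, X ω))
    (s : ∀ ω, X ω) : Prop :=
  ∃ (φ : SimpleFunc Ω ℕ) (u : ℕ → ∀ ω, X ω), (∀ i, u i ∈ L) ∧ ∀ ω, s ω = u (φ ω) ω

/-- A measurable section: an almost everywhere limit, in the metrics `ρ ω` of the fibres,
of a sequence of step sections. -/
def IsMeasurableSection {Ω : Type u} [MeasurableSpace Ω] (lam : Measure Ω) {X : Ω → Type v}
    (ρ : ∀ ω, X ω → X ω → ℝ) (L : Set (∀ ω, X ω)) (s : ∀ ω, X ω) : Prop :=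
  ∃ S : ℕ → ∀ ω, X ω, (∀ n, IsStepSection L (S n)) ∧
    ∀ᵐ ω ∂lam, Tendsto (fun n => ρ ω (S n ω) (s ω)) atTop (𝓝 0)

/-! ## Measurable bundles of Boolean algebras -/

/-- A measurable bundle of Boolean algebras over `(Ω, lam)`, with fibres the complete Boolean
algebras `B ω` with strictly positive measures `μ ω`. Sections are taken modulo equality almost
everywhere in the end, so that sections which are defined only almost everywhere
are represented by their extensions to all of `Ω`; accordingly the functions
`ω ↦ ρ_ω(e₁ ω, e₂ ω)` are measurable up to equality almost everywhere. -/
structure BooleanBundle {Ω : Type u} [MeasurableSpace Ω] (lam : Measure Ω) (B : Ω → Type v)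
    [∀ ω, CompleteBooleanAlgebra (B ω)] where
  /-- The measures of the fibres. -/
  μ : ∀ ω, B ω → ℝ
  isMeasure : ∀ ω, IsStrictlyPositiveMeasure (μ ω)
  /-- The set of sections. -/
  L : Set (∀ ω, B ω)
  nonempty : L.Nonempty
  aemeasurable : ∀ e₁ ∈ L, ∀ e₂ ∈ L, AEMeasurable (fun ω => μ ω (symmDiff (e₁ ω) (e₂ ω))) lam
  dense : ∀ (ω : Ω) (b : B ω) (ε : ℝ), 0 < ε → ∃ e ∈ L, μ ω (symmDiff (e ω) b) < ε
  compl_mem : ∀ e ∈ L, eᶜ ∈ L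
  sup_mem : ∀ e₁ ∈ L, ∀ e₂ ∈ L, e₁ ⊔ e₂ ∈ L

namespace IsStrictlyPositiveMeasure

variable {B : Type v} [CompleteBooleanAlgebra B] {m : B → ℝ}

theorem mono (hm : IsStrictlyPositiveMeasure m) {a b : B} (h : a ≤ b) : m a ≤ m b := by
  have h1 := hm.add a (b \ a) disjoint_sdiff_self_right
  rw [sup_sdiff_cancel_right h] at h1
  linarith [hm.nonneg (b \ a)]

theorem sup_le (hm : IsStrictlyPositiveMeasure m) (a b : B) : m (a ⊔ b) ≤ m a + m b := by
  have h1 := hm.add a (b \ a) disjoint_sdiff_self_right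
  rw [sup_sdiff_self_right] at h1
  linarith [hm.mono (sdiff_le : b \ a ≤ b)]

theorem symmDiff_sup_le (hm : IsStrictlyPositiveMeasure m) (a b c d : B) :
    m (symmDiff (a ⊔ b) (c ⊔ d)) ≤ m (symmDiff a c) + m (symmDiff b d) := by
  refine (hm.mono ?_).trans (hm.sup_le _ _)
  have key : ∀ p q r s : B, (p ⊔ q) \ (r ⊔ s) ≤ p \ r ⊔ q \ s := fun p q r s => by
    rw [sup_sdiff]
    exact sup_le_sup (sdiff_le_sdiff_left le_sup_left) (sdiff_le_sdiff_left le_sup_right)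
  rw [symmDiff_def, symmDiff_def, symmDiff_def]
  refine _root_.sup_le ((key a b c d).trans ?_) ((key c d a b).trans ?_)
  · exact sup_le_sup le_sup_left le_sup_left
  · exact sup_le_sup le_sup_right le_sup_right

end IsStrictlyPositiveMeasure

namespace BooleanBundle

variable {Ω : Type u} [MeasurableSpace Ω] {lam : Measure Ω} {B : Ω → Type v}
  [∀ ω, CompleteBooleanAlgebra (B ω)] (E : BooleanBundle lam B)

/-- The metric `ρ_ω(a, b) = μ_ω(a ∆ b)` of the fibre over `ω`. -/
def dist (ω : Ω) (a b : B ω) : ℝ := E.μ ω (symmDiff a b)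

theorem bot_mem : (⊥ : ∀ ω, B ω) ∈ E.L := by
  obtain ⟨e, he⟩ := E.nonempty
  have h := E.compl_mem _ (E.sup_mem e he _ (E.compl_mem e he))
  rwa [sup_compl_eq_top, compl_top] at h

theorem step_sup {s t : ∀ ω, B ω} (hs : IsStepSection E.L s) (ht : IsStepSection E.L t) :
    IsStepSection E.L (s ⊔ t) := by
  obtain ⟨φ, a, ha, hs⟩ := hs
  obtain ⟨ψ, b, hb, ht⟩ := ht
  refine ⟨(φ.pair ψ).map fun p => Nat.pair p.1 p.2, fun k => a k.unpair.1 ⊔ b k.unpair.2,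
    fun k => E.sup_mem _ (ha _) _ (hb _), fun ω => ?_⟩
  simp [hs, ht]

theorem step_compl {s : ∀ ω, B ω} (hs : IsStepSection E.L s) : IsStepSection E.L sᶜ := by
  obtain ⟨φ, a, ha, hs⟩ := hs
  exact ⟨φ, fun k => (a k)ᶜ, fun k => E.compl_mem _ (ha k), fun ω => by simp [hs]⟩

theorem meas_sup {s t : ∀ ω, B ω} (hs : IsMeasurableSection lam E.dist E.L s)
    (ht : IsMeasurableSection lam E.dist E.L t) :
    IsMeasurableSection lam E.dist E.L (s ⊔ t) := by
  obtain ⟨S, hS, hs⟩ := hs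
  obtain ⟨T, hT, ht⟩ := ht
  refine ⟨fun n => S n ⊔ T n, fun n => E.step_sup (hS n) (hT n), ?_⟩
  filter_upwards [hs, ht] with ω h1 h2
  have h3 := h1.add h2
  rw [add_zero] at h3
  exact squeeze_zero (fun n => (E.isMeasure ω).nonneg _)
    (fun n => (E.isMeasure ω).symmDiff_sup_le _ _ _ _) h3

theorem meas_compl {s : ∀ ω, B ω} (hs : IsMeasurableSection lam E.dist E.L s) :
    IsMeasurableSection lam E.dist E.L sᶜ := by
  obtain ⟨S, hS, hs⟩ := hs
  refine ⟨fun n => (S n)ᶜ, fun n => E.step_compl (hS n), ?_⟩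
  filter_upwards [hs] with ω h1
  simpa [dist, compl_symmDiff_compl] using h1

theorem meas_bot : IsMeasurableSection lam E.dist E.L (⊥ : ∀ ω, B ω) := by
  refine ⟨fun _ => ⊥, fun _ => ⟨SimpleFunc.const Ω 0, fun _ => ⊥, fun _ => E.bot_mem,
    fun _ => rfl⟩, Eventually.of_forall fun ω => ?_⟩
  have h := (E.isMeasure ω).add ⊥ ⊥ disjoint_bot_left
  rw [sup_idem] at h
  have h0 : E.μ ω ⊥ = 0 := by linarith
  simp [dist, h0]

/-- `M(Ω, ∇)`: the Boolean algebra of all measurable sections, with pointwise operations. -/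
def M : BooleanSubalgebra (∀ ω, B ω) where
  carrier := {s | IsMeasurableSection lam E.dist E.L s}
  supClosed' _ hs _ ht := E.meas_sup hs ht
  infClosed' s hs t ht := by
    have h := E.meas_compl (E.meas_sup (E.meas_compl hs) (E.meas_compl ht))
    rwa [compl_sup, compl_compl, compl_compl] at h
  compl_mem' hs := E.meas_compl hs
  bot_mem' := E.meas_bot

/-- Equality almost everywhere of measurable sections. -/
def aeSetoid : Setoid E.M where
  r s t := ∀ᵐ ω ∂lam, s.1 ω = t.1 ω
  iseqv :=
    { refl := fun _ => Eventually.of_forall fun _ => rfl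
      symm := fun h => h.mono fun _ h => h.symm
      trans := fun h1 h2 => by filter_upwards [h1, h2] with ω a b using a.trans b }

/-- `∇̂`: the classes of measurable sections modulo equality almost everywhere. -/
def Hat : Type (max u v) := Quotient E.aeSetoid

variable {E}

/-- The class of a measurable section. -/
def toHat (s : E.M) : E.Hat := Quotient.mk E.aeSetoid s

theorem toHat_eq {s t : E.M} (h : ∀ᵐ ω ∂lam, s.1 ω = t.1 ω) : toHat s = toHat t :=
  Quotient.sound (s := E.aeSetoid) h

/-- The order of `∇̂`: `ê ≤ ĝ` if and only if `e ω ≤ g ω` for almost every `ω`. -/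
instance instPartialOrderHat : PartialOrder E.Hat where
  le := Quotient.lift₂ (s₁ := E.aeSetoid) (s₂ := E.aeSetoid)
    (fun s t => ∀ᵐ ω ∂lam, s.1 ω ≤ t.1 ω) fun s t s' t' hs ht => propext <| by
      have hs : ∀ᵐ ω ∂lam, s.1 ω = s'.1 ω := hs
      have ht : ∀ᵐ ω ∂lam, t.1 ω = t'.1 ω := ht
      refine eventually_congr ?_
      filter_upwards [hs, ht] with ω h1 h2
      rw [h1, h2]
  le_refl := by
    rintro ⟨s⟩
    exact Eventually.of_forall fun _ => le_rfl
  le_trans := by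
    rintro ⟨r⟩ ⟨s⟩ ⟨t⟩ h1 h2
    have h1 : ∀ᵐ ω ∂lam, r.1 ω ≤ s.1 ω := h1
    have h2 : ∀ᵐ ω ∂lam, s.1 ω ≤ t.1 ω := h2
    show ∀ᵐ ω ∂lam, r.1 ω ≤ t.1 ω
    filter_upwards [h1, h2] with ω a b using a.trans b
  le_antisymm := by
    rintro ⟨s⟩ ⟨t⟩ h1 h2
    have h1 : ∀ᵐ ω ∂lam, s.1 ω ≤ t.1 ω := h1
    have h2 : ∀ᵐ ω ∂lam, t.1 ω ≤ s.1 ω := h2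
    refine toHat_eq ?_
    filter_upwards [h1, h2] with ω a b using le_antisymm a b

theorem toHat_le {s t : E.M} : toHat s ≤ toHat t ↔ ∀ᵐ ω ∂lam, s.1 ω ≤ t.1 ω := Iff.rfl

/-- The Boolean operations of `∇̂`, induced from those of `M(Ω, ∇)`. -/
instance instBooleanAlgebraHat : BooleanAlgebra E.Hat where
  sup := Quotient.map₂ (· ⊔ ·) fun s s' hs t t' ht => by
    have hs : ∀ᵐ ω ∂lam, s.1 ω = s'.1 ω := hs
    have ht : ∀ᵐ ω ∂lam, t.1 ω = t'.1 ω := ht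
    show ∀ᵐ ω ∂lam, s.1 ω ⊔ t.1 ω = s'.1 ω ⊔ t'.1 ω
    filter_upwards [hs, ht] with ω h1 h2
    rw [h1, h2]
  inf := Quotient.map₂ (· ⊓ ·) fun s s' hs t t' ht => by
    have hs : ∀ᵐ ω ∂lam, s.1 ω = s'.1 ω := hs
    have ht : ∀ᵐ ω ∂lam, t.1 ω = t'.1 ω := ht
    show ∀ᵐ ω ∂lam, s.1 ω ⊓ t.1 ω = s'.1 ω ⊓ t'.1 ω
    filter_upwards [hs, ht] with ω h1 h2
    rw [h1, h2]
  compl := Quotient.map (·ᶜ) fun s s' hs => by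
    have hs : ∀ᵐ ω ∂lam, s.1 ω = s'.1 ω := hs
    show ∀ᵐ ω ∂lam, (s.1 ω)ᶜ = (s'.1 ω)ᶜ
    filter_upwards [hs] with ω h1
    rw [h1]
  top := toHat ⊤
  bot := toHat ⊥
  le_sup_left := by
    rintro ⟨s⟩ ⟨t⟩
    exact Eventually.of_forall fun ω => (le_sup_left : s.1 ω ≤ s.1 ω ⊔ t.1 ω)
  le_sup_right := by
    rintro ⟨s⟩ ⟨t⟩
    exact Eventually.of_forall fun ω => (le_sup_right : t.1 ω ≤ s.1 ω ⊔ t.1 ω)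
  sup_le := by
    rintro ⟨r⟩ ⟨s⟩ ⟨t⟩ h1 h2
    have h1 : ∀ᵐ ω ∂lam, r.1 ω ≤ t.1 ω := h1
    have h2 : ∀ᵐ ω ∂lam, s.1 ω ≤ t.1 ω := h2
    show ∀ᵐ ω ∂lam, r.1 ω ⊔ s.1 ω ≤ t.1 ω
    filter_upwards [h1, h2] with ω a b using sup_le a b
  inf_le_left := by
    rintro ⟨s⟩ ⟨t⟩
    exact Eventually.of_forall fun ω => (inf_le_left : s.1 ω ⊓ t.1 ω ≤ s.1 ω)
  inf_le_right := by
    rintro ⟨s⟩ ⟨t⟩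
    exact Eventually.of_forall fun ω => (inf_le_right : s.1 ω ⊓ t.1 ω ≤ t.1 ω)
  le_inf := by
    rintro ⟨r⟩ ⟨s⟩ ⟨t⟩ h1 h2
    have h1 : ∀ᵐ ω ∂lam, r.1 ω ≤ s.1 ω := h1
    have h2 : ∀ᵐ ω ∂lam, r.1 ω ≤ t.1 ω := h2
    show ∀ᵐ ω ∂lam, r.1 ω ≤ s.1 ω ⊓ t.1 ω
    filter_upwards [h1, h2] with ω a b using le_inf a b
  le_sup_inf := by
    rintro ⟨r⟩ ⟨s⟩ ⟨t⟩
    exact Eventually.of_forall fun ω =>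
      (le_sup_inf : (r.1 ω ⊔ s.1 ω) ⊓ (r.1 ω ⊔ t.1 ω) ≤ r.1 ω ⊔ s.1 ω ⊓ t.1 ω)
  inf_compl_le_bot := by
    rintro ⟨s⟩
    exact Eventually.of_forall fun ω => (inf_compl_eq_bot : s.1 ω ⊓ (s.1 ω)ᶜ = ⊥).le
  top_le_sup_compl := by
    rintro ⟨s⟩
    exact Eventually.of_forall fun ω => (sup_compl_eq_top : s.1 ω ⊔ (s.1 ω)ᶜ = ⊤).ge
  le_top := by
    rintro ⟨s⟩
    exact Eventually.of_forall fun ω => (le_top : s.1 ω ≤ ⊤)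
  bot_le := by
    rintro ⟨s⟩
    exact Eventually.of_forall fun ω => (bot_le : ⊥ ≤ s.1 ω)

variable (E)

/-- The sections `∑ i, α i • e i` of the bundle of the spaces `L_0(∇_ω, μ_ω)`, with `α i ∈ ℝ` and
`e i ∈ M(Ω, ∇)`. -/
def simpleSections : Set (∀ ω, L0 (B ω)) :=
  {s | ∃ (n : ℕ) (α : Fin n → ℝ) (e : Fin n → E.M), s = fun ω => L0.simple α fun i => (e i).1 ω}

/-- The measurable sections of the bundle of the metric spaces `L_0(∇_ω, μ_ω)` with the metrics
`∫ |a - b| / (1 + |a - b|) dμ_ω`. -/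
def IsMeasurableL0Section (f : ∀ ω, L0 (B ω)) : Prop :=
  IsMeasurableSection lam (fun ω => L0.metric (E.μ ω)) E.simpleSections f

variable {E}

/-- The identification of elements of `L_0(∇̂, μ̂) = C_∞(Q(∇̂))` with sections `f ω ∈ L_0(∇_ω, μ_ω)`:
`F` is identified with the measurable section `f` if, for every real `t`, the element `[F > t]`
of `∇̂` is the class of a measurable section which is `[f ω > t]` for almost every `ω`. -/
def IsIdentifiedWith (F : L0 E.Hat) (f : ∀ ω, L0 (B ω)) : Prop :=
  E.IsMeasurableL0Section f ∧
    ∀ t : ℝ, ∃ e : E.M, L0.IsSuperlevel F t (toHat e) ∧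
      ∀ᵐ ω ∂lam, L0.IsSuperlevel (f ω) t (e.1 ω)

end BooleanBundle

/-!
An element of `C_∞(Q(B))` is the same thing as a resolution of the unit of `B`, as soon as `B` has
countable suprema: `f` corresponds to the family of its superlevel elements `[f > q]`, `q ∈ ℚ`,
which is right continuous and decreases from `⊤` to `⊥` (`L0.isResolution_of_isSuperlevel`,
`L0.IsResolution.exists_isSuperlevel`). Under this correspondence the order and the countable
suprema of `C_∞(Q(B))` are computed level by level (`L0.le_iff_superlevel`, `L0.isLUB_range_iff`),
and `f ↦ -f` carries suprema to infima.

Measurable sections of the bundle of Boolean algebras are closed under limits almost everywhere,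
hence under countable suprema; consequently `∇̂` has countable suprema and they are computed
fibrewise (`BooleanBundle.isLUB_toHat_iff`). All the conditions that define a resolution of the unit
involve only countable suprema and infima, so a family of measurable sections indexed by `ℚ` gives a
resolution in `∇̂` if and only if it gives one in almost every fibre. This yields the section of an
element of `L_0(∇̂, μ̂)` and, conversely, the element of a section whose superlevel elements are
measurable; such a section is a limit of simple sections, since `f ω` is approximated by
simple elements on a grid of levels (`L0.tendsto_metric_grid`). The order and countable
suprema and infima in `L_0(∇̂, μ̂)` are therefore those of almost every fibre.

For (i), the nets that bound an `(o)`-convergent net of `L_0(∇̂, μ̂)` are carried to the fibres; the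
index set is countable, so countably many exceptional null sets suffice. For (ii), the bounding
nets in the fibres need not be measurable, and they are replaced by the suprema and infima of the
tails of `f n ω`. These are countable, hence measurable, and they converge monotonically to the limit
because the index set is directed.
-/

/-! ### Points of the Stone space -/

namespace StoneSpace

variable {B : Type v} [BooleanAlgebra B]

theorem mem_basic {b : B} {x : StoneSpace B} : x ∈ basic b ↔ b ∈ x.carrier := Iff.rfl

theorem bot_notMem (x : StoneSpace B) : ⊥ ∉ x.carrier := by
  rw [← x.compl_mem_iff, compl_bot]
  exact x.top_mem

/-- A filter and an ideal that are disjoint are separated by an ultrafilter: the Boolean prime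
ideal theorem in terms of points of the Stone space. -/
theorem exists_separating {Φ I : Set B} (hΦt : ⊤ ∈ Φ) (hΦu : ∀ a ∈ Φ, ∀ b, a ≤ b → b ∈ Φ)
    (hΦi : ∀ a ∈ Φ, ∀ b ∈ Φ, a ⊓ b ∈ Φ) (hIb : ⊥ ∈ I) (hIl : ∀ a ∈ I, ∀ b, b ≤ a → b ∈ I)
    (hIs : ∀ a ∈ I, ∀ b ∈ I, a ⊔ b ∈ I) (hd : Disjoint Φ I) :
    ∃ x : StoneSpace B, (∀ c ∈ Φ, c ∈ x.carrier) ∧ ∀ c ∈ I, c ∉ x.carrier := by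
  have hF : Order.IsPFilter Φ := Order.IsPFilter.of_def ⟨⊤, hΦt⟩
    (fun a ha b hb => ⟨a ⊓ b, hΦi a ha b hb, inf_le_left, inf_le_right⟩)
    (fun {a b} hab ha => hΦu a ha b hab)
  have hJ : Order.IsIdeal I := ⟨fun a b hba ha => hIl a ha b hba, ⟨⊥, hIb⟩,
    fun a ha b hb => ⟨a ⊔ b, hIs a ha b hb, le_sup_left, le_sup_right⟩⟩
  obtain ⟨J, hJp, hIJ, hFJ⟩ := DistribLattice.prime_ideal_of_disjoint_filter_ideal
    (F := hF.toPFilter) (I := hJ.toIdeal) hd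
  have htop : ⊤ ∉ J := fun h => Set.disjoint_left.1 hFJ hΦt h
  refine ⟨⟨{b | b ∉ J}, htop, fun a b ha hab hb => ha (J.lower hab hb),
    fun a b ha hb hab => (hJp.mem_or_mem hab).elim ha hb, fun a => ⟨fun h h' => ?_, fun h h' => ?_⟩⟩,
    fun c hc hcJ => Set.disjoint_left.1 hFJ hc hcJ, fun c hc hcJ => hcJ (hIJ hc)⟩
  · exact (hJp.mem_or_compl_mem (x := a)).elim h' h
  · have := Order.Ideal.sup_mem (not_not.1 h) h'
    rw [sup_compl_eq_top] at this
    exact htop this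

theorem exists_mem_of_ne_bot {b : B} (hb : b ≠ ⊥) : ∃ x : StoneSpace B, b ∈ x.carrier := by
  obtain ⟨x, hx, -⟩ := exists_separating (Φ := Set.Ici b) (I := {⊥}) (le_top : b ≤ ⊤)
    (fun a (ha : b ≤ a) c hac => ha.trans hac) (fun a (ha : b ≤ a) c (hc : b ≤ c) => le_inf ha hc)
    rfl (fun a (ha : a = ⊥) c hc => le_bot_iff.1 (hc.trans ha.le))
    (fun a (ha : a = ⊥) c (hc : c = ⊥) => by simp [ha, hc])
    (Set.disjoint_singleton_right.2 fun h : b ≤ ⊥ => hb (le_bot_iff.1 h))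
  exact ⟨x, hx b le_rfl⟩

theorem le_iff {a b : B} : a ≤ b ↔ ∀ x : StoneSpace B, a ∈ x.carrier → b ∈ x.carrier := by
  refine ⟨fun h x hx => x.mem_of_le _ _ hx h, fun h => ?_⟩
  by_contra hab
  obtain ⟨x, hx⟩ := exists_mem_of_ne_bot (b := a \ b) fun h => hab (sdiff_eq_bot_iff.1 h)
  rw [sdiff_eq] at hx
  exact (x.compl_mem_iff b).1 (x.mem_of_le _ _ hx inf_le_right)
    (h x (x.mem_of_le _ _ hx inf_le_left))

/-- The clopen sets of the elements of the Boolean algebra form a basis of the Stone topology. -/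
theorem exists_basic_subset {U : Set (StoneSpace B)} (hU : IsOpen U) {x : StoneSpace B}
    (hx : x ∈ U) : ∃ c : B, c ∈ x.carrier ∧ basic c ⊆ U := by
  have hb := TopologicalSpace.isTopologicalBasis_of_subbasis_of_inter
    (r := Set.range (basic (B := B))) rfl (by
      rintro _ ⟨a, rfl⟩ _ ⟨b, rfl⟩
      exact ⟨a ⊓ b, Set.ext fun x => ⟨fun h => ⟨x.mem_of_le _ _ h inf_le_left,
        x.mem_of_le _ _ h inf_le_right⟩, fun h => x.inf_mem _ _ h.1 h.2⟩⟩)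
  obtain ⟨V, hV, hxV, hVU⟩ := hb.exists_subset_of_mem_open hx hU
  rcases hV with rfl | ⟨c, rfl⟩
  · exact ⟨⊤, x.top_mem, fun y _ => hVU trivial⟩
  · exact ⟨c, hxV, hVU⟩

end StoneSpace

/-! ### Superlevel elements and resolutions of the unit -/

namespace L0

variable {B : Type v} [BooleanAlgebra B] {f g : L0 B} {s t : ℝ} {a b : B} {x : StoneSpace B}

theorem exists_basic_lt (h : (t : EReal) < f.val x) :
    ∃ c ∈ x.carrier, ∀ y ∈ StoneSpace.basic c, (t : EReal) < f.val y :=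
  StoneSpace.exists_basic_subset (isOpen_lt continuous_const f.1.continuous) h

theorem exists_basic_gt (h : f.val x < t) :
    ∃ c ∈ x.carrier, ∀ y ∈ StoneSpace.basic c, f.val y < t :=
  StoneSpace.exists_basic_subset (isOpen_lt f.1.continuous continuous_const) h

/-- The function `f` is finite somewhere on the clopen set of a nonzero element. -/
theorem exists_finite (f : L0 B) (hb : b ≠ ⊥) :
    ∃ x : StoneSpace B, b ∈ x.carrier ∧ f.val x ≠ ⊥ ∧ f.val x ≠ ⊤ := by
  obtain ⟨y, hy⟩ := StoneSpace.exists_mem_of_ne_bot hb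
  obtain ⟨x, hx, hf⟩ := f.2.exists_mem_open (StoneSpace.isClopen_basic b).2 ⟨y, hy⟩
  exact ⟨x, hf, hx⟩

theorem IsSuperlevel.mem_of_lt (h : IsSuperlevel f t b) (hx : (t : EReal) < f.val x) :
    b ∈ x.carrier := by
  obtain ⟨c, hc, hcf⟩ := exists_basic_lt hx
  exact x.mem_of_le _ _ hc (h.1 hcf)

theorem IsSuperlevel.le_of_mem (h : IsSuperlevel f t b) (hx : b ∈ x.carrier) :
    (t : EReal) ≤ f.val x := by
  by_contra hlt
  obtain ⟨c, hc, hcf⟩ := exists_basic_gt (not_le.1 hlt)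
  refine (x.compl_mem_iff c).1 (x.mem_of_le _ _ hx (h.2 fun d hd => ?_)) hc
  refine StoneSpace.le_iff.2 fun y hy => (y.compl_mem_iff c).2 fun hyc => ?_
  exact (hd y hy).not_gt (hcf y hyc)

theorem IsSuperlevel.unique (ha : IsSuperlevel f t a) (hb : IsSuperlevel f t b) : a = b :=
  IsLUB.unique ha hb

theorem exists_rat_btwn_ereal {a b : EReal} (h : a < b) : ∃ q : ℚ, a < ((q : ℝ) : EReal) ∧
    ((q : ℝ) : EReal) < b :=
  EReal.lt_iff_exists_rat_btwn.1 h

/-- The order of `C_∞(Q(B))` is the order of the rational superlevel elements. -/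
theorem le_iff_superlevel {c d : ℚ → B} (hf : ∀ q : ℚ, IsSuperlevel f q (c q))
    (hg : ∀ q : ℚ, IsSuperlevel g q (d q)) : f ≤ g ↔ ∀ q, c q ≤ d q := by
  refine ⟨fun h q => (hf q).2 fun e he => (hg q).1 fun x hx => (he x hx).trans_le (h x),
    fun h x => ?_⟩
  by_contra hlt
  obtain ⟨q, hq1, hq2⟩ := exists_rat_btwn_ereal (not_le.1 hlt)
  exact ((hg q).le_of_mem (StoneSpace.le_iff.1 (h q) x ((hf q).mem_of_lt hq2))).not_gt hq1

/-- The superlevel elements are continuous from the right in the level. -/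
theorem isSuperlevel_iff_isLUB {c : ℚ → B} (hf : ∀ q : ℚ, IsSuperlevel f q (c q)) :
    IsSuperlevel f t b ↔ IsLUB (Set.range fun q : {q : ℚ // t < q} => c q) b := by
  refine isLUB_congr (Set.ext fun u => ⟨?_, fun h d hd => ?_⟩)
  · rintro h _ ⟨⟨q, hq⟩, rfl⟩
    exact (hf q).2 fun d hd => h fun x hx => lt_trans (by exact_mod_cast hq) (hd x hx)
  · refine StoneSpace.le_iff.2 fun x hx => ?_
    obtain ⟨q, hq1, hq2⟩ := exists_rat_btwn_ereal (hd x hx)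
    exact x.mem_of_le _ _ ((hf q).mem_of_lt hq2) (h ⟨⟨q, by exact_mod_cast hq1⟩, rfl⟩)

/-- Every element of `C_∞(Q(B))` has superlevel elements when `B` is countably complete. -/
theorem exists_isSuperlevel (hB : ∀ u : ℕ → B, ∃ b, IsLUB (Set.range u) b) (f : L0 B) (t : ℝ) :
    ∃ b, IsSuperlevel f t b := by
  -- For `t < s` a clopen set lies between `{f ≥ s}` and `{f > t}`: otherwise an ultrafilter
  -- separates the filter of the clopen sets above `{f ≥ s}` from the ideal of those in `{f > t}`.
  have key : ∀ s : ℝ, t < s → ∃ c : B, (∀ x, (s : EReal) ≤ f.val x → c ∈ x.carrier) ∧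
      ∀ x, c ∈ x.carrier → (t : EReal) < f.val x := by
    intro s hs
    by_contra! hcon
    obtain ⟨x, hx1, hx2⟩ := StoneSpace.exists_separating
      (Φ := {c : B | ∀ x, (s : EReal) ≤ f.val x → c ∈ x.carrier})
      (I := {c : B | ∀ x : StoneSpace B, c ∈ x.carrier → (t : EReal) < f.val x})
      (fun x _ => x.top_mem) (fun a ha b hab x hx => x.mem_of_le _ _ (ha x hx) hab)
      (fun a ha b hb x hx => x.inf_mem _ _ (ha x hx) (hb x hx))
      (fun x hx => (x.bot_notMem hx).elim)
      (fun a ha b hba x hx => ha x (x.mem_of_le _ _ hx hba))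
      (fun a ha b hb x hx => by
        by_contra hlt
        have h1 := x.inf_mem _ _ ((x.compl_mem_iff a).2 fun h => hlt (ha x h))
          ((x.compl_mem_iff b).2 fun h => hlt (hb x h))
        rw [← compl_sup] at h1
        exact (x.compl_mem_iff _).1 h1 hx)
      (Set.disjoint_left.2 fun c h1 h2 => by
        obtain ⟨x, hx, hx'⟩ := hcon c h1
        exact hx'.not_gt (h2 x hx))
    rcases lt_or_ge (f.val x) s with h | h
    · obtain ⟨c, hc, hcf⟩ := exists_basic_gt h
      refine (x.compl_mem_iff c).1 (hx1 cᶜ fun y hy => (y.compl_mem_iff c).2 fun hyc => ?_) hc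
      exact hy.not_gt (hcf y hyc)
    · obtain ⟨c, hc, hcf⟩ := exists_basic_lt (lt_of_lt_of_le (EReal.coe_lt_coe_iff.2 hs) h)
      exact hx2 c hcf hc
  choose c hc1 hc2 using fun n : ℕ => key (t + 1 / ((n : ℝ) + 1))
    (lt_add_of_pos_right _ Nat.one_div_pos_of_nat)
  obtain ⟨b, hb⟩ := hB c
  refine ⟨b, fun d hd => StoneSpace.le_iff.2 fun x hx => ?_, fun u hu => hb.2 ?_⟩
  · obtain ⟨r, hr1, hr2⟩ := EReal.lt_iff_exists_real_btwn.1 (hd x hx)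
    obtain ⟨n, hn⟩ := exists_nat_one_div_lt (sub_pos.2 (EReal.coe_lt_coe_iff.1 hr1))
    refine x.mem_of_le _ _ (hc1 n x (le_trans (EReal.coe_le_coe_iff.2 ?_) hr2.le)) (hb.1 ⟨n, rfl⟩)
    linarith
  · rintro _ ⟨n, rfl⟩
    exact hu (hc2 n)

/-- `c` is a resolution of the unit indexed by the rational numbers: it is right continuous and
decreases from `⊤` to `⊥`. -/
structure IsResolution (c : ℚ → B) : Prop where
  isLUB_Ioi : ∀ q, IsLUB (Set.range fun r : Set.Ioi q => c r) (c q)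
  isLUB_top : IsLUB (Set.range c) ⊤
  isGLB_bot : IsGLB (Set.range c) ⊥

theorem isResolution_of_isSuperlevel {c : ℚ → B} (hf : ∀ q : ℚ, IsSuperlevel f q (c q)) :
    IsResolution c := by
  refine ⟨fun q => ?_, ⟨fun _ _ => le_top, fun u hu => ?_⟩, ⟨fun _ _ => bot_le, fun u hu => ?_⟩⟩
  · refine ⟨?_, fun u hu => ?_⟩
    · rintro _ ⟨⟨r, hr⟩, rfl⟩
      exact ((isSuperlevel_iff_isLUB hf).1 (hf q)).1 ⟨⟨r, by exact_mod_cast hr⟩, rfl⟩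
    · refine ((isSuperlevel_iff_isLUB hf).1 (hf q)).2 ?_
      rintro _ ⟨⟨r, hr⟩, rfl⟩
      exact hu ⟨⟨r, by exact_mod_cast hr⟩, rfl⟩
  · by_contra hne
    obtain ⟨x, hx, hxb, -⟩ := f.exists_finite (b := uᶜ) fun h =>
      hne (by rw [compl_eq_bot.1 h])
    obtain ⟨q, -, hq⟩ := exists_rat_btwn_ereal (bot_lt_iff_ne_bot.2 hxb)
    exact (x.compl_mem_iff u).1 hx (x.mem_of_le _ _ ((hf q).mem_of_lt hq) (hu ⟨q, rfl⟩))
  · by_contra hne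
    obtain ⟨x, hx, -, hxt⟩ := f.exists_finite (b := u) fun h => hne h.le
    obtain ⟨q, hq, -⟩ := exists_rat_btwn_ereal (lt_top_iff_ne_top.2 hxt)
    exact ((hf q).le_of_mem (x.mem_of_le _ _ hx (hu ⟨q, rfl⟩))).not_gt hq

theorem IsResolution.antitone {c : ℚ → B} (hc : IsResolution c) : Antitone c := fun q r h => by
  rcases h.eq_or_lt with rfl | h
  · exact le_rfl
  · exact (hc.isLUB_Ioi q).1 ⟨⟨r, h⟩, rfl⟩

/-- Every resolution of the unit consists of the superlevel elements of an element of
`C_∞(Q(B))`, namely of `x ↦ sup {q | c q ∈ x}`. -/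
theorem IsResolution.exists_isSuperlevel {c : ℚ → B} (hc : IsResolution c) :
    ∃ f : L0 B, ∀ q : ℚ, IsSuperlevel f q (c q) := by
  let F : StoneSpace B → EReal := fun x => ⨆ q : {q : ℚ // c q ∈ x.carrier}, ((q.1 : ℝ) : EReal)
  have hle : ∀ {x : StoneSpace B} {q : ℚ}, c q ∈ x.carrier → ((q : ℝ) : EReal) ≤ F x :=
    fun {x q} h => le_iSup (fun q : {q : ℚ // c q ∈ x.carrier} => ((q.1 : ℝ) : EReal)) ⟨q, h⟩
  have hge : ∀ {x : StoneSpace B} {q : ℚ}, c q ∉ x.carrier → F x ≤ ((q : ℝ) : EReal) := by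
    refine fun {x q} h => iSup_le fun ⟨r, hr⟩ => ?_
    have : r ≤ q := le_of_not_gt fun hqr => h (x.mem_of_le _ _ hr (hc.antitone hqr.le))
    exact_mod_cast this
  have hlt : ∀ {x : StoneSpace B} {a : EReal}, a < F x ↔
      ∃ q : ℚ, a < ((q : ℝ) : EReal) ∧ c q ∈ x.carrier := by
    refine fun {x a} => ⟨fun h => ?_, fun ⟨q, h1, h2⟩ => h1.trans_le (hle h2)⟩
    obtain ⟨⟨q, hq⟩, h⟩ := lt_iSup_iff.1 h
    exact ⟨q, h, hq⟩
  have hgt : ∀ {x : StoneSpace B} {a : EReal}, F x < a ↔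
      ∃ q : ℚ, ((q : ℝ) : EReal) < a ∧ (c q)ᶜ ∈ x.carrier := by
    refine fun {x a} => ⟨fun h => ?_,
      fun ⟨q, h1, h2⟩ => (hge ((x.compl_mem_iff _).1 h2)).trans_lt h1⟩
    obtain ⟨q, h1, h2⟩ := exists_rat_btwn_ereal h
    exact ⟨q, h2, (x.compl_mem_iff _).2 fun hq => (hle hq).not_gt h1⟩
  have hcont : Continuous F := by
    refine OrderTopology.continuous_iff.2 fun a => ⟨?_, ?_⟩
    · have : F ⁻¹' Set.Ioi a = ⋃ q : {q : ℚ // a < ((q : ℝ) : EReal)},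
          StoneSpace.basic (c q.1) := by
        ext x
        simp only [Set.mem_preimage, Set.mem_Ioi, hlt, Set.mem_iUnion, StoneSpace.mem_basic,
          Subtype.exists, exists_prop]
      rw [this]
      exact isOpen_iUnion fun q => (StoneSpace.isClopen_basic _).2
    · have : F ⁻¹' Set.Iio a = ⋃ q : {q : ℚ // ((q : ℝ) : EReal) < a},
          StoneSpace.basic (c q.1)ᶜ := by
        ext x
        simp only [Set.mem_preimage, Set.mem_Iio, hgt, Set.mem_iUnion, StoneSpace.mem_basic,
          Subtype.exists, exists_prop]
      rw [this]
      exact isOpen_iUnion fun q => (StoneSpace.isClopen_basic _).2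
  -- Below any nonzero `b` there is a nonzero `b ⊓ c q ⊓ (c r)ᶜ`, where `q ≤ F ≤ r`.
  have hdense : Dense {x | F x ≠ ⊥ ∧ F x ≠ ⊤} := by
    refine dense_iff_inter_open.2 fun U hU ⟨y, hy⟩ => ?_
    obtain ⟨b, hb, hbU⟩ := StoneSpace.exists_basic_subset hU hy
    have h1 : ∃ q, b ⊓ c q ≠ ⊥ := by
      by_contra! h
      have h2 : (⊤ : B) ≤ bᶜ := hc.isLUB_top.2 <| by
        rintro _ ⟨q, rfl⟩
        exact le_compl_iff_disjoint_left.2 (disjoint_iff.2 (h q))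
      exact (y.compl_mem_iff b).1 (y.mem_of_le _ _ y.top_mem h2) hb
    obtain ⟨q, hq⟩ := h1
    have h1 : ∃ r, (b ⊓ c q) ⊓ (c r)ᶜ ≠ ⊥ := by
      by_contra! h
      refine hq (le_bot_iff.1 (hc.isGLB_bot.2 ?_))
      rintro _ ⟨r, rfl⟩
      exact disjoint_compl_right_iff.1 (disjoint_iff.2 (h r))
    obtain ⟨r, hr⟩ := h1
    obtain ⟨x, hx⟩ := StoneSpace.exists_mem_of_ne_bot hr
    have hxb := x.mem_of_le _ _ hx (inf_le_left.trans inf_le_left)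
    have hxq := x.mem_of_le _ _ hx (inf_le_left.trans inf_le_right)
    have hxr := x.mem_of_le _ _ hx inf_le_right
    exact ⟨x, hbU hxb, ((EReal.bot_lt_coe _).trans_le (hle hxq)).ne',
      ((hge ((x.compl_mem_iff _).1 hxr)).trans_lt (EReal.coe_lt_top _)).ne⟩
  refine ⟨⟨⟨F, hcont⟩, hdense⟩, fun q => ⟨fun d hd => StoneSpace.le_iff.2 fun x hx => ?_,
    fun u hu => (hc.isLUB_Ioi q).2 ?_⟩⟩
  · obtain ⟨r, hr, hrx⟩ := hlt.1 (hd x hx)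
    exact x.mem_of_le _ _ hrx (hc.antitone (by exact_mod_cast hr.le))
  · rintro _ ⟨⟨r, hr⟩, rfl⟩
    exact hu fun x hx => lt_of_lt_of_le (by exact_mod_cast hr) (hle hx)

theorem nonempty : Nonempty (L0 B) := ⟨simple (n := 0) (fun _ => 0) fun _ => ⊥⟩

/-! ### Suprema and negation -/

section Countable

variable {ι : Type w} [Countable ι] [Nonempty ι]

theorem exists_isLUB_range (hB : ∀ u : ℕ → B, ∃ b, IsLUB (Set.range u) b) (u : ι → B) :
    ∃ b, IsLUB (Set.range u) b := by
  obtain ⟨φ, hφ⟩ := exists_surjective_nat ι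
  rw [← hφ.range_comp]
  exact hB _

variable {F : ι → L0 B} {c : ι → ℚ → B}

/-- The suprema of the superlevel elements of a countable bounded family are the superlevel
elements of its supremum. -/
theorem exists_isLUB_of_bddAbove (hB : ∀ u : ℕ → B, ∃ b, IsLUB (Set.range u) b)
    (hF : ∀ i (q : ℚ), IsSuperlevel (F i) q (c i q)) (hbdd : BddAbove (Set.range F)) :
    ∃ a, IsLUB (Set.range F) a ∧ ∃ d : ℚ → B, (∀ q : ℚ, IsSuperlevel a q (d q)) ∧
      ∀ q, IsLUB (Set.range fun i => c i q) (d q) := by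
  choose d hd using fun q => exists_isLUB_range hB fun i => c i q
  obtain ⟨h, hh⟩ := hbdd
  choose e he using fun q : ℚ => exists_isSuperlevel hB h q
  have hres : ∀ i, IsResolution (c i) := fun i => isResolution_of_isSuperlevel (hF i)
  have hde : ∀ q, d q ≤ e q := fun q => (hd q).2 <| by
    rintro _ ⟨i, rfl⟩
    exact (le_iff_superlevel (hF i) he).1 (hh ⟨i, rfl⟩) q
  have hdres : IsResolution d := by
    refine ⟨fun q => ⟨?_, fun u hu => (hd q).2 ?_⟩, ⟨fun _ _ => le_top, fun u hu => ?_⟩,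
      ⟨fun _ _ => bot_le, fun u hu => (isResolution_of_isSuperlevel he).isGLB_bot.2 ?_⟩⟩
    · rintro _ ⟨⟨r, hr⟩, rfl⟩
      refine (hd r).2 ?_
      rintro _ ⟨i, rfl⟩
      exact ((hres i).antitone (le_of_lt hr)).trans ((hd q).1 ⟨i, rfl⟩)
    · rintro _ ⟨i, rfl⟩
      refine ((hres i).isLUB_Ioi q).2 ?_
      rintro _ ⟨r, rfl⟩
      exact ((hd r).1 ⟨i, rfl⟩).trans (hu ⟨r, rfl⟩)
    · refine (hres (Classical.arbitrary ι)).isLUB_top.2 ?_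
      rintro _ ⟨q, rfl⟩
      exact ((hd q).1 ⟨_, rfl⟩).trans (hu ⟨q, rfl⟩)
    · rintro _ ⟨q, rfl⟩
      exact (hu ⟨q, rfl⟩).trans (hde q)
  obtain ⟨a, ha⟩ := hdres.exists_isSuperlevel
  refine ⟨a, ⟨?_, fun g hg => ?_⟩, d, ha, hd⟩
  · rintro _ ⟨i, rfl⟩
    exact (le_iff_superlevel (hF i) ha).2 fun q => (hd q).1 ⟨i, rfl⟩
  · choose k hk using fun q : ℚ => exists_isSuperlevel hB g q
    refine (le_iff_superlevel ha hk).2 fun q => (hd q).2 ?_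
    rintro _ ⟨i, rfl⟩
    exact (le_iff_superlevel (hF i) hk).1 (hg ⟨i, rfl⟩) q

/-- Countable suprema in `C_∞(Q(B))` are the suprema of the superlevel elements. -/
theorem isLUB_range_iff (hB : ∀ u : ℕ → B, ∃ b, IsLUB (Set.range u) b) {a : L0 B} {d : ℚ → B}
    (hF : ∀ i (q : ℚ), IsSuperlevel (F i) q (c i q)) (ha : ∀ q : ℚ, IsSuperlevel a q (d q)) :
    IsLUB (Set.range F) a ↔ ∀ q, IsLUB (Set.range fun i => c i q) (d q) := by
  constructor
  · intro h q
    obtain ⟨a', ha', d', hd', hc⟩ := exists_isLUB_of_bddAbove hB hF ⟨a, h.1⟩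
    obtain rfl := h.unique ha'
    rw [(ha q).unique (hd' q)]
    exact hc q
  · intro h
    have hub : a ∈ upperBounds (Set.range F) := by
      rintro _ ⟨i, rfl⟩
      exact (le_iff_superlevel (hF i) ha).2 fun q => (h q).1 ⟨i, rfl⟩
    obtain ⟨a', ha', d', hd', hc⟩ := exists_isLUB_of_bddAbove hB hF ⟨a, hub⟩
    have : a = a' := le_antisymm
      ((le_iff_superlevel ha hd').2 fun q => ((h q).unique (hc q)).le) (ha'.2 hub)
    rwa [this]

end Countable

/-- The function `-f`. -/
noncomputable def neg (f : L0 B) : L0 B :=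
  ⟨⟨fun x => -f.1 x, continuous_neg.comp f.1.continuous⟩, by
    convert f.2 using 3
    simp [and_comm]⟩

theorem neg_le_neg_iff : neg f ≤ neg g ↔ g ≤ f :=
  forall_congr' fun _ => EReal.neg_le_neg_iff

theorem neg_neg (f : L0 B) : neg (neg f) = f :=
  Subtype.ext (ContinuousMap.ext fun _ => _root_.neg_neg _)

theorem isLUB_range_neg {ι : Type w} {F : ι → L0 B} :
    IsLUB (Set.range fun i => neg (F i)) (neg f) ↔ IsGLB (Set.range F) f := by
  constructor
  · refine fun h => ⟨?_, fun g hg => neg_le_neg_iff.1 (h.2 ?_)⟩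
    · rintro _ ⟨i, rfl⟩
      exact neg_le_neg_iff.1 (h.1 ⟨i, rfl⟩)
    · rintro _ ⟨i, rfl⟩
      exact neg_le_neg_iff.2 (hg ⟨i, rfl⟩)
  · refine fun h => ⟨?_, fun g hg => ?_⟩
    · rintro _ ⟨i, rfl⟩
      exact neg_le_neg_iff.2 (h.1 ⟨i, rfl⟩)
    · rw [← neg_neg g, neg_le_neg_iff]
      refine h.2 ?_
      rintro _ ⟨i, rfl⟩
      rw [← neg_le_neg_iff, neg_neg]
      exact hg ⟨i, rfl⟩

/-- `[-f > t]` is the supremum of the complements of `[f > q]` for rational `q < -t`. -/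
theorem isSuperlevel_neg_iff {c : ℚ → B} (hf : ∀ q : ℚ, IsSuperlevel f q (c q)) :
    IsSuperlevel (neg f) t b ↔ IsLUB (Set.range fun q : {q : ℚ // (q : ℝ) < -t} => (c q)ᶜ) b := by
  refine isLUB_congr (Set.ext fun u => ⟨?_, fun h d hd => ?_⟩)
  · rintro h _ ⟨⟨q, hq⟩, rfl⟩
    refine h fun x hx => EReal.lt_neg_comm.1 (lt_of_le_of_lt (b := ((q : ℝ) : EReal)) ?_ ?_)
    · exact not_lt.1 fun hlt => (x.compl_mem_iff _).1 hx ((hf q).mem_of_lt hlt)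
    · exact_mod_cast hq
  · refine StoneSpace.le_iff.2 fun x hx => ?_
    obtain ⟨q, hq1, hq2⟩ := exists_rat_btwn_ereal (EReal.lt_neg_comm.1 (hd x hx))
    exact x.mem_of_le _ _ ((x.compl_mem_iff _).2 fun hq => ((hf q).le_of_mem hq).not_gt hq1)
      (h ⟨⟨q, by exact_mod_cast hq2⟩, rfl⟩)

end L0

/-! ### Approximation in the metric of the fibres -/

namespace L0

variable {B : Type v} [CompleteBooleanAlgebra B] {m : B → ℝ}

/-- Approximation of `f` up to `δ k → 0` outside the clopen set of `d k`, with `m (d k) → 0`, gives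
convergence in the metric: for `t > 0` the integrand that defines the metric is eventually at
most `m (d k)`. -/
theorem tendsto_metric_zero (hm : IsStrictlyPositiveMeasure m) {a : ℕ → L0 B} {f : L0 B}
    {d : ℕ → B} {δ : ℕ → ℝ} (hδ : Tendsto δ atTop (𝓝 0))
    (hd : Tendsto (fun k => m (d k)) atTop (𝓝 0))
    (h : ∀ k (x : StoneSpace B), d k ∉ x.carrier →
      |((a k).val x).toReal - (f.val x).toReal| ≤ δ k) :
    Tendsto (fun k => metric m (a k) f) atTop (𝓝 0) := by
  have hlim := intervalIntegral.tendsto_integral_filter_of_dominated_convergence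
    (μ := volume) (a := 0) (b := 1) (l := atTop) (f := fun _ => (0 : ℝ))
    (F := fun (k : ℕ) (t : ℝ) => m (sSup {c : B | ∀ x ∈ StoneSpace.basic c,
      ((a k).val x ≠ ⊥ ∧ (a k).val x ≠ ⊤) ∧ (f.val x ≠ ⊥ ∧ f.val x ≠ ⊤) ∧
        t < |((a k).val x).toReal - (f.val x).toReal| /
          (1 + |((a k).val x).toReal - (f.val x).toReal|)}))
    (fun _ => m ⊤) ?_ ?_ intervalIntegrable_const ?_
  · rwa [intervalIntegral.integral_zero] at hlim
  · refine Eventually.of_forall fun k => Measurable.aestronglyMeasurable (Antitone.measurable ?_)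
    exact fun s t hst => hm.mono (sSup_le_sSup fun c hc x hx =>
      ⟨(hc x hx).1, (hc x hx).2.1, hst.trans_lt (hc x hx).2.2⟩)
  · refine Eventually.of_forall fun k => Eventually.of_forall fun t _ => ?_
    rw [Real.norm_of_nonneg (hm.nonneg _)]
    exact hm.mono le_top
  · refine Eventually.of_forall fun t ht => ?_
    rw [Set.uIoc_of_le zero_le_one] at ht
    refine squeeze_zero' (Eventually.of_forall fun k => hm.nonneg _) ?_ hd
    filter_upwards [hδ.eventually_lt_const ht.1] with k hk
    refine hm.mono (sSup_le fun c hc => StoneSpace.le_iff.2 fun x hx => ?_)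
    by_contra hdx
    have h1 := h k x hdx
    have h2 := (hc x hx).2.2
    have h3 : |((a k).val x).toReal - (f.val x).toReal| /
        (1 + |((a k).val x).toReal - (f.val x).toReal|) ≤
        |((a k).val x).toReal - (f.val x).toReal| :=
      div_le_self (abs_nonneg _) (by linarith [abs_nonneg (((a k).val x).toReal - (f.val x).toReal)])
    linarith

/-- Counting the points `a + i * δ`, `i < n`, below `y` recovers `y` up to `δ`; the predicate `P`
may decide either way at `y` itself. -/
theorem abs_grid_sub_le {a δ y : ℝ} (hδ : 0 ≤ δ) (n : ℕ) (P : ℕ → Prop) [DecidablePred P]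
    (h1 : ∀ i, P i → a + i * δ ≤ y) (h2 : ∀ i, ¬ P i → y ≤ a + i * δ) (hay : a ≤ y)
    (hya : y ≤ a + n * δ) : |a + ((Finset.range n).filter P).card * δ - y| ≤ δ := by
  set S := (Finset.range n).filter P with hS
  rw [abs_le]
  constructor
  · have hle : S.card ≤ n := (Finset.card_filter_le _ _).trans (Finset.card_range n).le
    rcases hle.eq_or_lt with h | h
    · rw [h]
      linarith
    · have : ∃ i ∈ Finset.range (S.card + 1), i ∉ S := by
        by_contra! hcon
        have := Finset.card_le_card (show Finset.range (S.card + 1) ⊆ S from hcon)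
        simp at this
      obtain ⟨i, hi, hiS⟩ := this
      have hi' : i ≤ S.card := Nat.lt_succ_iff.1 (Finset.mem_range.1 hi)
      have hP : ¬ P i := fun hP =>
        hiS (Finset.mem_filter.2 ⟨Finset.mem_range.2 (hi'.trans_lt h), hP⟩)
      have := h2 i hP
      have : (i : ℝ) * δ ≤ S.card * δ := by gcongr
      linarith
  · rcases S.eq_empty_or_nonempty with h | h
    · rw [h]
      simp only [Finset.card_empty, Nat.cast_zero]
      linarith
    · have hmax := S.max'_mem h
      have hsub : S ⊆ Finset.range (S.max' h + 1) := fun i hi =>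
        Finset.mem_range.2 (Nat.lt_succ_iff.2 (S.le_max' i hi))
      have hcard := Finset.card_le_card hsub
      rw [Finset.card_range] at hcard
      have h3 := h1 _ (Finset.mem_filter.1 hmax).2
      have h4 : (S.card : ℝ) * δ ≤ (S.max' h + 1 : ℕ) * δ := by gcongr
      push_cast at h4
      linarith

/-- The coefficients of the simple function that approximates `f` from the levels
`-(k + 1) + i / (k + 1)`. -/
noncomputable def gridCoeff (k : ℕ) : Fin (2 * (k + 1) ^ 2 + 1) → ℝ :=
  Fin.cons (-(k + 1 : ℝ)) fun _ => 1 / (k + 1 : ℝ)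

/-- The superlevel elements of the levels `-(k + 1) + i / (k + 1)`, preceded by `⊤`. -/
def gridElem {C : Type w} [Top C] (c : ℚ → C) (k : ℕ) : Fin (2 * (k + 1) ^ 2 + 1) → C :=
  Fin.cons ⊤ fun i => c (-(k + 1 : ℚ) + i * (1 / (k + 1 : ℚ)))

open Classical in
theorem simple_grid_val (c : ℚ → B) (k : ℕ) (x : StoneSpace B) :
    (simple (gridCoeff k) (gridElem c k)).val x = ((-(k + 1 : ℝ) +
      ((Finset.range (2 * (k + 1) ^ 2)).filter fun i : ℕ =>
        c (-(k + 1 : ℚ) + i * (1 / (k + 1 : ℚ))) ∈ x.carrier).card * (1 / (k + 1 : ℝ)) : ℝ) :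
      EReal) := by
  change ((∑ i, if x ∈ StoneSpace.basic (gridElem c k i) then gridCoeff k i else 0 : ℝ) : EReal) = _
  congr 1
  rw [Fin.sum_univ_succ]
  congr 1
  · simp [gridCoeff, gridElem, StoneSpace.mem_basic, x.top_mem]
  · simp only [gridCoeff, gridElem, Fin.cons_succ, StoneSpace.mem_basic]
    rw [Fin.sum_univ_eq_sum_range (fun i : ℕ =>
      if c (-(k + 1 : ℚ) + i * (1 / (k + 1 : ℚ))) ∈ x.carrier then 1 / (k + 1 : ℝ) else 0),
      ← Finset.sum_filter, Finset.sum_const, nsmul_eq_mul]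

/-- The simple functions built from the superlevel elements of `f` converge to `f`. -/
theorem tendsto_metric_grid (hm : IsStrictlyPositiveMeasure m) {f : L0 B} {c : ℚ → B}
    (hf : ∀ q : ℚ, IsSuperlevel f q (c q)) :
    Tendsto (fun k => metric m (simple (gridCoeff k) (gridElem c k)) f) atTop (𝓝 0) := by
  classical
  have hc := isResolution_of_isSuperlevel hf
  -- Outside the clopen set of `[f > k + 1] ⊔ [f > -(k + 1)]ᶜ` the values of `f` lie within the grid.
  refine tendsto_metric_zero hm (d := fun k => c (k + 1 : ℚ) ⊔ (c (-(k + 1 : ℚ)))ᶜ)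
    (tendsto_one_div_add_atTop_nhds_zero_nat (𝕜 := ℝ)) ?_ fun k x hx => ?_
  · have h1 : Tendsto (fun k : ℕ => m (c (k + 1 : ℚ))) atTop (𝓝 0) := by
      refine hm.tendsto_zero _ (fun i j hij => hc.antitone (by gcongr)) ?_
      refine le_bot_iff.1 (hc.isGLB_bot.2 ?_)
      rintro _ ⟨q, rfl⟩
      obtain ⟨k, hk⟩ := exists_nat_ge q
      exact (iInf_le _ k).trans (hc.antitone (by linarith))
    have h2 : Tendsto (fun k : ℕ => m (c (-(k + 1 : ℚ)))ᶜ) atTop (𝓝 0) := by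
      refine hm.tendsto_zero _ (fun i j hij => compl_le_compl (hc.antitone ?_)) ?_
      · exact neg_le_neg (by gcongr)
      · rw [← compl_iSup, compl_eq_bot, ← top_le_iff]
        refine hc.isLUB_top.2 ?_
        rintro _ ⟨q, rfl⟩
        obtain ⟨k, hk⟩ := exists_nat_ge (-q)
        exact le_iSup_of_le k (hc.antitone (by linarith))
    have h3 := h1.add h2
    rw [add_zero] at h3
    exact squeeze_zero (fun k => hm.nonneg _) (fun k => hm.sup_le _ _) h3
  · have hx1 : c (k + 1 : ℚ) ∉ x.carrier := fun h => hx (x.mem_of_le _ _ h le_sup_left)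
    have hx2 : c (-(k + 1 : ℚ)) ∈ x.carrier := by
      by_contra h
      exact hx (x.mem_of_le _ _ ((x.compl_mem_iff _).2 h) le_sup_right)
    have hle : f.val x ≤ ((k + 1 : ℝ) : EReal) := by
      have := not_lt.1 fun h => hx1 ((hf _).mem_of_lt h)
      push_cast at this ⊢
      exact this
    have hge : ((-(k + 1 : ℝ) : ℝ) : EReal) ≤ f.val x := by
      have := (hf _).le_of_mem hx2
      push_cast at this ⊢
      exact this
    obtain ⟨y, hy⟩ : ∃ y : ℝ, f.val x = y :=
      ⟨_, (EReal.coe_toReal (ne_top_of_le_ne_top (EReal.coe_ne_top _) hle)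
        (ne_bot_of_le_ne_bot (EReal.coe_ne_bot _) hge)).symm⟩
    rw [simple_grid_val, hy, EReal.toReal_coe, EReal.toReal_coe]
    rw [hy, EReal.coe_le_coe_iff] at hle hge
    refine abs_grid_sub_le (by positivity) _ _ (fun i hi => ?_) (fun i hi => ?_) hge ?_
    · have := (hf _).le_of_mem hi
      rw [hy, EReal.coe_le_coe_iff] at this
      push_cast at this
      exact this
    · have := not_lt.1 fun h => hi ((hf _).mem_of_lt h)
      rw [hy, EReal.coe_le_coe_iff] at this
      push_cast at this
      exact this
    · refine hle.trans (le_of_eq ?_)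
      push_cast
      field_simp
      ring

end L0

/-! ### Countable suprema of measurable sections -/

namespace IsStrictlyPositiveMeasure

variable {B : Type v} [CompleteBooleanAlgebra B] {m : B → ℝ}

theorem apply_bot (hm : IsStrictlyPositiveMeasure m) : m ⊥ = 0 := by
  have h := hm.add ⊥ ⊥ disjoint_bot_left
  rw [sup_idem] at h
  linarith

theorem symmDiff_triangle (hm : IsStrictlyPositiveMeasure m) (a b c : B) :
    m (symmDiff a c) ≤ m (symmDiff a b) + m (symmDiff b c) :=
  (hm.mono (_root_.symmDiff_triangle a b c)).trans (hm.sup_le _ _)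

/-- The metric `m (a ∆ b)` is jointly continuous. -/
theorem abs_symmDiff_sub_le (hm : IsStrictlyPositiveMeasure m) (a b c d : B) :
    |m (symmDiff a b) - m (symmDiff c d)| ≤ m (symmDiff a c) + m (symmDiff b d) := by
  have h1 := hm.symmDiff_triangle a c b
  have h2 := hm.symmDiff_triangle c d b
  have h3 := hm.symmDiff_triangle c a d
  have h4 := hm.symmDiff_triangle a b d
  rw [symmDiff_comm d b] at h2
  rw [symmDiff_comm c a] at h3
  exact abs_le.2 ⟨by linarith, by linarith⟩

theorem tendsto_symmDiff_iSup (hm : IsStrictlyPositiveMeasure m) {e : ℕ → B} (he : Monotone e) :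
    Tendsto (fun n => m (symmDiff (e n) (⨆ k, e k))) atTop (𝓝 0) := by
  simp_rw [symmDiff_of_le (le_iSup e _)]
  refine hm.tendsto_zero _ (fun i j hij => sdiff_le_sdiff_left (he hij)) (le_bot_iff.1 ?_)
  have h1 : Disjoint (⨅ n, (⨆ k, e k) \ e n) (⨆ k, e k) :=
    disjoint_iSup_iff.2 fun k => disjoint_sdiff_self_left.mono_left (iInf_le _ k)
  exact h1 le_rfl ((iInf_le _ 0).trans sdiff_le)

end IsStrictlyPositiveMeasure

namespace BooleanBundle

variable {Ω : Type u} [MeasurableSpace Ω] {lam : Measure Ω} {B : Ω → Type v}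
  [∀ ω, CompleteBooleanAlgebra (B ω)] {E : BooleanBundle lam B}

theorem aemeasurable_dist_of_step {s t : ∀ ω, B ω} (hs : IsStepSection E.L s)
    (ht : IsStepSection E.L t) : AEMeasurable (fun ω => E.dist ω (s ω) (t ω)) lam := by
  obtain ⟨φ, a, ha, hs⟩ := hs
  obtain ⟨ψ, b, hb, ht⟩ := ht
  choose g hg hgae using fun p : ℕ × ℕ => E.aemeasurable _ (ha p.1) _ (hb p.2)
  have hmeas : Measurable fun z : Ω × (ℕ × ℕ) => g z.2 z.1 :=
    measurable_from_prod_countable_left hg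
  refine ⟨fun ω => g (φ ω, ψ ω) ω,
    hmeas.comp (measurable_id.prodMk (φ.measurable.prodMk ψ.measurable)), ?_⟩
  filter_upwards [ae_all_iff.2 hgae] with ω hω
  rw [← hω (φ ω, ψ ω), hs, ht]
  rfl

theorem isMeasurableSection_of_step {s : ∀ ω, B ω} (hs : IsStepSection E.L s) :
    IsMeasurableSection lam E.dist E.L s :=
  ⟨fun _ => s, fun _ => hs, Eventually.of_forall fun ω => by
    simp [dist, (E.isMeasure ω).apply_bot]⟩

theorem aemeasurable_dist {s t : ∀ ω, B ω} (hs : IsMeasurableSection lam E.dist E.L s)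
    (ht : IsMeasurableSection lam E.dist E.L t) :
    AEMeasurable (fun ω => E.dist ω (s ω) (t ω)) lam := by
  obtain ⟨S, hS, hs⟩ := hs
  obtain ⟨T, hT, ht⟩ := ht
  refine aemeasurable_of_tendsto_metrizable_ae' (fun n => aemeasurable_dist_of_step (hS n) (hT n)) ?_
  filter_upwards [hs, ht] with ω h1 h2
  have h3 := h1.add h2
  rw [add_zero] at h3
  exact tendsto_iff_norm_sub_tendsto_zero.2 (squeeze_zero (fun _ => norm_nonneg _)
    (fun n => (E.isMeasure ω).abs_symmDiff_sub_le _ _ _ _) h3)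

/-- Measurable sections are closed under limits almost everywhere: on the diagonal one has
convergence in measure, hence almost everywhere along a subsequence. -/
theorem isMeasurableSection_of_tendsto [IsFiniteMeasure lam] {T : ℕ → ∀ ω, B ω} {s : ∀ ω, B ω}
    (hT : ∀ k, IsMeasurableSection lam E.dist E.L (T k))
    (h : ∀ᵐ ω ∂lam, Tendsto (fun k => E.dist ω (T k ω) (s ω)) atTop (𝓝 0)) :
    IsMeasurableSection lam E.dist E.L s := by
  have hT' := hT
  choose S hS hlim using hT'
  have hmeas := fun k => tendstoInMeasure_of_tendsto_ae
    (fun n => (aemeasurable_dist (isMeasurableSection_of_step (hS k n))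
      (hT k)).aestronglyMeasurable) (hlim k)
  have hex : ∀ k : ℕ, ∃ n, lam {ω | (k : ENNReal)⁻¹ ≤ edist (E.dist ω (S k n ω) (T k ω)) 0} <
      (k : ENNReal)⁻¹ := fun k =>
    have hk : (0 : ENNReal) < (k : ENNReal)⁻¹ := ENNReal.inv_pos.2 (ENNReal.natCast_ne_top k)
    ((hmeas k _ hk).eventually_lt_const hk).exists
  choose n hn using hex
  have hdiag : TendstoInMeasure lam (fun k ω => E.dist ω (S k (n k) ω) (T k ω)) atTop
      fun _ => 0 := by
    intro ε hε
    refine tendsto_of_tendsto_of_tendsto_of_le_of_le' tendsto_const_nhds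
      ENNReal.tendsto_inv_nat_nhds_zero (Eventually.of_forall fun _ => zero_le) ?_
    filter_upwards [ENNReal.tendsto_inv_nat_nhds_zero.eventually_lt_const hε] with k hk
    exact (measure_mono fun ω hω => hk.le.trans hω).trans (hn k).le
  obtain ⟨ns, hns, hae⟩ := hdiag.exists_seq_tendsto_ae
  refine ⟨fun i => S (ns i) (n (ns i)), fun i => hS _ _, ?_⟩
  filter_upwards [hae, h] with ω h1 h2
  have h3 := h1.add (h2.comp hns.tendsto_atTop)
  rw [add_zero] at h3
  exact squeeze_zero (fun i => (E.isMeasure ω).nonneg _)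
    (fun i => (E.isMeasure ω).symmDiff_triangle _ _ _) h3

theorem isMeasurableSection_iSup_nat [IsFiniteMeasure lam] (s : ℕ → E.M) :
    IsMeasurableSection lam E.dist E.L fun ω => ⨆ n, (s n).1 ω := by
  have h1 : ∀ n, IsMeasurableSection lam E.dist E.L (partialSups (fun n => (s n).1) n) := by
    intro n
    induction n with
    | zero => rw [partialSups_zero]; exact (s 0).2
    | succ n ih => rw [partialSups_add_one]; exact E.meas_sup ih (s (n + 1)).2
  refine isMeasurableSection_of_tendsto h1 (Eventually.of_forall fun ω => ?_)
  simp_rw [Pi.partialSups_apply]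
  rw [← iSup_partialSups_eq]
  exact (E.isMeasure ω).tendsto_symmDiff_iSup (partialSups _).monotone

theorem isMeasurableSection_iSup [IsFiniteMeasure lam] {ι : Type w} [Countable ι] (s : ι → E.M) :
    IsMeasurableSection lam E.dist E.L fun ω => ⨆ i, (s i).1 ω := by
  rcases isEmpty_or_nonempty ι with h | h
  · simp only [iSup_of_empty]
    exact E.meas_bot
  · obtain ⟨φ, hφ⟩ := exists_surjective_nat ι
    simp_rw [← hφ.iSup_comp]
    exact isMeasurableSection_iSup_nat _

end BooleanBundle

namespace BooleanBundle

variable {Ω : Type u} [MeasurableSpace Ω] {lam : Measure Ω} {B : Ω → Type v}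
  [∀ ω, CompleteBooleanAlgebra (B ω)] {E : BooleanBundle lam B}

/-! ### Countable suprema in the algebra of classes of measurable sections -/

theorem toHat_surjective : Function.Surjective (toHat : E.M → E.Hat) := Quotient.exists_rep

theorem toHat_eq_iff {s t : E.M} : toHat s = toHat t ↔ ∀ᵐ ω ∂lam, s.1 ω = t.1 ω :=
  ⟨fun h => Quotient.exact (s := E.aeSetoid) h, toHat_eq⟩

theorem toHat_compl (s : E.M) : (toHat s)ᶜ = toHat sᶜ := rfl

/-- The supremum of countably many measurable sections. -/
def iSupM [IsFiniteMeasure lam] {ι : Type w} [Countable ι] (s : ι → E.M) : E.M :=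
  ⟨fun ω => ⨆ i, (s i).1 ω, isMeasurableSection_iSup s⟩

theorem isLUB_range_compl {C : Type*} [BooleanAlgebra C] {ι : Type w} {a : ι → C} {b : C} :
    IsLUB (Set.range fun i => (a i)ᶜ) bᶜ ↔ IsGLB (Set.range a) b := by
  constructor
  · refine fun h => ⟨?_, fun g hg => compl_le_compl_iff_le.1 (h.2 ?_)⟩
    · rintro _ ⟨i, rfl⟩
      exact compl_le_compl_iff_le.1 (h.1 ⟨i, rfl⟩)
    · rintro _ ⟨i, rfl⟩
      exact compl_le_compl (hg ⟨i, rfl⟩)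
  · refine fun h => ⟨?_, fun g hg => compl_le_iff_compl_le.1 (h.2 ?_)⟩
    · rintro _ ⟨i, rfl⟩
      exact compl_le_compl (h.1 ⟨i, rfl⟩)
    · rintro _ ⟨i, rfl⟩
      exact compl_le_iff_compl_le.1 (hg ⟨i, rfl⟩)

/-- Countable suprema in `∇̂` are computed fibrewise. -/
theorem isLUB_toHat_iff [IsFiniteMeasure lam] {ι : Type w} [Countable ι] {s : ι → E.M}
    {t : E.M} : IsLUB (Set.range fun i => toHat (s i)) (toHat t) ↔
      ∀ᵐ ω ∂lam, IsLUB (Set.range fun i => (s i).1 ω) (t.1 ω) := by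
  have key : ∀ t : E.M, (∀ᵐ ω ∂lam, IsLUB (Set.range fun i => (s i).1 ω) (t.1 ω)) →
      IsLUB (Set.range fun i => toHat (s i)) (toHat t) := by
    refine fun t h => ⟨?_, fun u hu => ?_⟩
    · rintro _ ⟨i, rfl⟩
      exact toHat_le.2 (h.mono fun ω hω => hω.1 ⟨i, rfl⟩)
    · obtain ⟨u, rfl⟩ := toHat_surjective u
      have hu' : ∀ᵐ ω ∂lam, ∀ i, (s i).1 ω ≤ u.1 ω :=
        ae_all_iff.2 fun i => toHat_le.1 (hu ⟨i, rfl⟩)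
      refine toHat_le.2 ?_
      filter_upwards [h, hu'] with ω h1 h2
      refine h1.2 ?_
      rintro _ ⟨i, rfl⟩
      exact h2 i
  refine ⟨fun h => ?_, key t⟩
  have h1 := toHat_eq_iff.1 (h.unique (key (iSupM s) (Eventually.of_forall fun ω => isLUB_iSup)))
  filter_upwards [h1] with ω hω
  rw [hω]
  exact isLUB_iSup

theorem isGLB_toHat_iff [IsFiniteMeasure lam] {ι : Type w} [Countable ι] {s : ι → E.M}
    {t : E.M} : IsGLB (Set.range fun i => toHat (s i)) (toHat t) ↔
      ∀ᵐ ω ∂lam, IsGLB (Set.range fun i => (s i).1 ω) (t.1 ω) := by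
  have h := isLUB_toHat_iff (s := fun i => (s i)ᶜ) (t := tᶜ)
  simp_rw [← toHat_compl] at h
  rw [isLUB_range_compl] at h
  exact h.trans (eventually_congr (Eventually.of_forall fun ω => isLUB_range_compl))

theorem exists_isLUB_hat [IsFiniteMeasure lam] (u : ℕ → E.Hat) : ∃ b, IsLUB (Set.range u) b := by
  choose s hs using fun n => toHat_surjective (u n)
  obtain rfl : (fun n => toHat (s n)) = u := funext hs
  exact ⟨toHat (iSupM s), isLUB_toHat_iff.2 (Eventually.of_forall fun ω => isLUB_iSup)⟩

theorem isResolution_toHat_iff [IsFiniteMeasure lam] {e : ℚ → E.M} :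
    L0.IsResolution (fun q => toHat (e q)) ↔
      ∀ᵐ ω ∂lam, L0.IsResolution fun q => (e q).1 ω := by
  have h1 : (∀ q, IsLUB (Set.range fun r : Set.Ioi q => toHat (e r)) (toHat (e q))) ↔
      ∀ᵐ ω ∂lam, ∀ q, IsLUB (Set.range fun r : Set.Ioi q => (e r).1 ω) ((e q).1 ω) := by
    rw [ae_all_iff]
    exact forall_congr' fun q => isLUB_toHat_iff
  have h2 : IsLUB (Set.range fun q => toHat (e q)) ⊤ ↔
      ∀ᵐ ω ∂lam, IsLUB (Set.range fun q => (e q).1 ω) ⊤ := isLUB_toHat_iff (t := ⊤)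
  have h3 : IsGLB (Set.range fun q => toHat (e q)) ⊥ ↔
      ∀ᵐ ω ∂lam, IsGLB (Set.range fun q => (e q).1 ω) ⊥ := isGLB_toHat_iff (t := ⊥)
  constructor
  · intro h
    filter_upwards [h1.1 h.isLUB_Ioi, h2.1 h.isLUB_top, h3.1 h.isGLB_bot] with ω a b c
    exact ⟨a, b, c⟩
  · intro h
    exact ⟨h1.2 (h.mono fun ω h => h.isLUB_Ioi), h2.2 (h.mono fun ω h => h.isLUB_top),
      h3.2 (h.mono fun ω h => h.isGLB_bot)⟩

/-! ### Identification of elements of `L_0(∇̂, μ̂)` with sections -/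

/-- The measurable sections `e q` are the superlevel elements `[f ω > q]`, `q ∈ ℚ`, of the section
`f` almost everywhere. -/
def HasSuperlevels (f : ∀ ω, L0 (B ω)) (e : ℚ → E.M) : Prop :=
  ∀ᵐ ω ∂lam, ∀ q : ℚ, L0.IsSuperlevel (f ω) q ((e q).1 ω)

theorem HasSuperlevels.isMeasurableL0Section {f : ∀ ω, L0 (B ω)} {e : ℚ → E.M}
    (h : HasSuperlevels f e) : E.IsMeasurableL0Section f := by
  refine ⟨fun k ω => L0.simple (L0.gridCoeff k) (L0.gridElem (fun q => (e q).1 ω) k),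
    fun k => ⟨SimpleFunc.const Ω 0, fun _ ω => L0.simple (L0.gridCoeff k)
      (L0.gridElem (fun q => (e q).1 ω) k), fun _ => ⟨_, L0.gridCoeff k, L0.gridElem e k, ?_⟩,
      fun _ => rfl⟩, ?_⟩
  · exact funext fun ω => congrArg (L0.simple _) (funext fun i =>
      Fin.cases (motive := fun i => L0.gridElem (fun q => (e q).1 ω) k i =
        (L0.gridElem e k i).1 ω) rfl (fun _ => rfl) i)
  · filter_upwards [h] with ω hω
    exact L0.tendsto_metric_grid (E.isMeasure ω) hω

/-- It suffices to know the superlevel elements at the rational levels. -/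
theorem HasSuperlevels.isIdentifiedWith [IsFiniteMeasure lam] {f : ∀ ω, L0 (B ω)} {e : ℚ → E.M}
    (h : HasSuperlevels f e) {F : L0 E.Hat}
    (hF : ∀ q : ℚ, L0.IsSuperlevel F q (toHat (e q))) : IsIdentifiedWith F f := by
  refine ⟨h.isMeasurableL0Section, fun t =>
    ⟨iSupM fun q : {q : ℚ // t < q} => e q, ?_, ?_⟩⟩
  · rw [L0.isSuperlevel_iff_isLUB hF]
    exact isLUB_toHat_iff.2 (Eventually.of_forall fun ω => isLUB_iSup)
  · filter_upwards [h] with ω hω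
    rw [L0.isSuperlevel_iff_isLUB hω]
    exact isLUB_iSup

theorem IsIdentifiedWith.exists_superlevels {F : L0 E.Hat} {f : ∀ ω, L0 (B ω)}
    (h : IsIdentifiedWith F f) : ∃ e : ℚ → E.M,
      (∀ q : ℚ, L0.IsSuperlevel F q (toHat (e q))) ∧ HasSuperlevels f e := by
  choose e h1 h2 using fun q : ℚ => h.2 q
  exact ⟨e, h1, ae_all_iff.2 h2⟩

/-- A section with measurable superlevel elements comes from an element of `L_0(∇̂, μ̂)`. -/
theorem HasSuperlevels.exists_isIdentifiedWith [IsFiniteMeasure lam] {f : ∀ ω, L0 (B ω)}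
    {e : ℚ → E.M} (h : HasSuperlevels f e) : ∃ F : L0 E.Hat, IsIdentifiedWith F f := by
  obtain ⟨F, hF⟩ := (isResolution_toHat_iff.2
    (h.mono fun ω hω => L0.isResolution_of_isSuperlevel hω)).exists_isSuperlevel
  exact ⟨F, h.isIdentifiedWith hF⟩

/-- Every element of `L_0(∇̂, μ̂)` comes from a measurable section, obtained from representatives of
its superlevel elements: they form a resolution of the unit in almost every fibre. -/
theorem exists_isIdentifiedWith [IsFiniteMeasure lam] (F : L0 E.Hat) :
    ∃ f : ∀ ω, L0 (B ω), IsIdentifiedWith F f := by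
  classical
  choose c hc using fun q : ℚ => L0.exists_isSuperlevel exists_isLUB_hat F q
  choose e he using fun q => toHat_surjective (c q)
  obtain rfl : (fun q => toHat (e q)) = c := funext he
  have hres := isResolution_toHat_iff.1 (L0.isResolution_of_isSuperlevel hc)
  have hex : ∀ ω, ∃ g : L0 (B ω), L0.IsResolution (fun q => (e q).1 ω) →
      ∀ q : ℚ, L0.IsSuperlevel g q ((e q).1 ω) := fun ω => by
    by_cases h : L0.IsResolution fun q => (e q).1 ω
    · obtain ⟨g, hg⟩ := h.exists_isSuperlevel
      exact ⟨g, fun _ => hg⟩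
    · exact ⟨L0.nonempty.some, fun h' => (h h').elim⟩
  choose f hf using hex
  have hfe : HasSuperlevels f e := hres.mono fun ω hω => hf ω hω
  exact ⟨f, hfe.isIdentifiedWith hc⟩

theorem IsIdentifiedWith.le_iff {F G : L0 E.Hat} {f g : ∀ ω, L0 (B ω)}
    (hF : IsIdentifiedWith F f) (hG : IsIdentifiedWith G g) :
    F ≤ G ↔ ∀ᵐ ω ∂lam, f ω ≤ g ω := by
  obtain ⟨c, hFc, hfc⟩ := hF.exists_superlevels
  obtain ⟨d, hGd, hgd⟩ := hG.exists_superlevels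
  rw [L0.le_iff_superlevel hFc hGd]
  simp_rw [toHat_le]
  rw [← ae_all_iff]
  refine eventually_congr ?_
  filter_upwards [hfc, hgd] with ω h1 h2
  rw [L0.le_iff_superlevel h1 h2]

variable [IsFiniteMeasure lam]

section Countable

variable {ι : Type w} [Countable ι] [Nonempty ι]

/-- Countable suprema in `L_0(∇̂, μ̂)` are computed fibrewise. -/
theorem isLUB_iff_of_isIdentifiedWith {F : ι → L0 E.Hat} {f : ι → ∀ ω, L0 (B ω)}
    (hF : ∀ i, IsIdentifiedWith (F i) (f i)) {G : L0 E.Hat} {g : ∀ ω, L0 (B ω)}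
    (hG : IsIdentifiedWith G g) :
    IsLUB (Set.range F) G ↔ ∀ᵐ ω ∂lam, IsLUB (Set.range fun i => f i ω) (g ω) := by
  choose c hFc hfc using fun i => (hF i).exists_superlevels
  obtain ⟨d, hGd, hgd⟩ := hG.exists_superlevels
  rw [L0.isLUB_range_iff exists_isLUB_hat hFc hGd]
  simp_rw [isLUB_toHat_iff]
  rw [← ae_all_iff]
  refine eventually_congr ?_
  filter_upwards [ae_all_iff.2 hfc, hgd] with ω h1 h2
  rw [L0.isLUB_range_iff (fun _ => ⟨_, isLUB_iSup⟩) h1 h2]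

/-- A fibrewise countable supremum of sections that come from `L_0(∇̂, μ̂)` comes from
`L_0(∇̂, μ̂)`. -/
theorem exists_isIdentifiedWith_of_isLUB {F : ι → L0 E.Hat} {f : ι → ∀ ω, L0 (B ω)}
    (hF : ∀ i, IsIdentifiedWith (F i) (f i)) {g : ∀ ω, L0 (B ω)}
    (hg : ∀ᵐ ω ∂lam, IsLUB (Set.range fun i => f i ω) (g ω)) :
    ∃ G : L0 E.Hat, IsIdentifiedWith G g := by
  choose c hFc hfc using fun i => (hF i).exists_superlevels
  refine HasSuperlevels.exists_isIdentifiedWith (e := fun q => iSupM fun i => c i q) ?_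
  filter_upwards [ae_all_iff.2 hfc, hg] with ω h1 h2
  obtain ⟨a, ha, d, hd, hdc⟩ := L0.exists_isLUB_of_bddAbove (fun _ => ⟨_, isLUB_iSup⟩) h1 ⟨_, h2.1⟩
  intro q
  rw [h2.unique ha, show (iSupM fun i => c i q).1 ω = d q from isLUB_iSup.unique (hdc q)]
  exact hd q

end Countable

theorem IsIdentifiedWith.neg {F : L0 E.Hat} {f : ∀ ω, L0 (B ω)} (h : IsIdentifiedWith F f) :
    IsIdentifiedWith (L0.neg F) fun ω => L0.neg (f ω) := by
  obtain ⟨c, hFc, hfc⟩ := h.exists_superlevels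
  refine HasSuperlevels.isIdentifiedWith
    (e := fun q => iSupM fun r : {r : ℚ // (r : ℝ) < -(q : ℝ)} => (c r)ᶜ) ?_ fun q => ?_
  · filter_upwards [hfc] with ω hω q
    rw [L0.isSuperlevel_neg_iff hω]
    exact isLUB_iSup
  · rw [L0.isSuperlevel_neg_iff hFc]
    exact isLUB_toHat_iff.2 (Eventually.of_forall fun ω => isLUB_iSup)

section Countable

variable {ι : Type w} [Countable ι] [Nonempty ι]

theorem isGLB_iff_of_isIdentifiedWith {F : ι → L0 E.Hat} {f : ι → ∀ ω, L0 (B ω)}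
    (hF : ∀ i, IsIdentifiedWith (F i) (f i)) {G : L0 E.Hat} {g : ∀ ω, L0 (B ω)}
    (hG : IsIdentifiedWith G g) :
    IsGLB (Set.range F) G ↔ ∀ᵐ ω ∂lam, IsGLB (Set.range fun i => f i ω) (g ω) := by
  rw [← L0.isLUB_range_neg, isLUB_iff_of_isIdentifiedWith (fun i => (hF i).neg) hG.neg]
  simp_rw [L0.isLUB_range_neg]

theorem exists_isIdentifiedWith_of_isGLB {F : ι → L0 E.Hat} {f : ι → ∀ ω, L0 (B ω)}
    (hF : ∀ i, IsIdentifiedWith (F i) (f i)) {g : ∀ ω, L0 (B ω)}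
    (hg : ∀ᵐ ω ∂lam, IsGLB (Set.range fun i => f i ω) (g ω)) :
    ∃ G : L0 E.Hat, IsIdentifiedWith G g := by
  simp_rw [← L0.isLUB_range_neg] at hg
  obtain ⟨G, hG⟩ := exists_isIdentifiedWith_of_isLUB (fun i => (hF i).neg) hg
  refine ⟨L0.neg G, ?_⟩
  simpa only [L0.neg_neg] using hG.neg

end Countable

end BooleanBundle

/-! ### Order convergence -/

/-- The suprema of the tails of an `(o)`-convergent net decrease to its limit. -/
theorem OConverges.isGLB_of_isLUB_tails {ι : Type w} [Preorder ι] [IsDirectedOrder ι] {X : Type v}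
    [PartialOrder X] {f : ι → X} {a : X} (h : OConverges f a) {R : ι → X}
    (hR : ∀ n, IsLUB (Set.range fun m : Set.Ici n => f m.1) (R n)) : IsGLB (Set.range R) a := by
  obtain ⟨l, r, hl, hla, hr, hra, hf⟩ := h
  refine ⟨?_, fun b hb => hra.2 ?_⟩
  · rintro _ ⟨n, rfl⟩
    refine hla.2 ?_
    rintro _ ⟨k, rfl⟩
    obtain ⟨m, hkm, hnm⟩ := exists_ge_ge k n
    exact ((hl hkm).trans (hf m).1).trans ((hR n).1 ⟨⟨m, hnm⟩, rfl⟩)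
  · rintro _ ⟨n, rfl⟩
    refine (hb ⟨n, rfl⟩).trans ((hR n).2 ?_)
    rintro _ ⟨⟨m, hm⟩, rfl⟩
    exact (hf m).2.trans (hr hm)

/-- The infima of the tails of an `(o)`-convergent net increase to its limit. -/
theorem OConverges.isLUB_of_isGLB_tails {ι : Type w} [Preorder ι] [IsDirectedOrder ι] {X : Type v}
    [PartialOrder X] {f : ι → X} {a : X} (h : OConverges f a) {R : ι → X}
    (hR : ∀ n, IsGLB (Set.range fun m : Set.Ici n => f m.1) (R n)) : IsLUB (Set.range R) a := by
  obtain ⟨l, r, hl, hla, hr, hra, hf⟩ := h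
  exact OConverges.isGLB_of_isLUB_tails (X := Xᵒᵈ)
    ⟨r, l, hr, hra, hl, hla, fun i => ⟨(hf i).2, (hf i).1⟩⟩ hR

namespace L0

variable {C : Type v} [CompleteBooleanAlgebra C]

theorem exists_isLUB {ι : Type w} [Countable ι] [Nonempty ι] {f : ι → L0 C}
    (h : BddAbove (Set.range f)) : ∃ a, IsLUB (Set.range f) a := by
  have hC : ∀ u : ℕ → C, ∃ b, IsLUB (Set.range u) b := fun u => ⟨_, isLUB_iSup⟩
  choose c hc using fun i (q : ℚ) => exists_isSuperlevel hC (f i) q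
  obtain ⟨a, ha, -⟩ := exists_isLUB_of_bddAbove hC hc h
  exact ⟨a, ha⟩

theorem exists_isGLB {ι : Type w} [Countable ι] [Nonempty ι] {f : ι → L0 C}
    (h : BddBelow (Set.range f)) : ∃ a, IsGLB (Set.range f) a := by
  obtain ⟨b, hb⟩ := h
  obtain ⟨a, ha⟩ := exists_isLUB (f := fun i => neg (f i)) ⟨neg b, by
    rintro _ ⟨i, rfl⟩
    exact neg_le_neg_iff.2 (hb ⟨i, rfl⟩)⟩
  exact ⟨neg a, isLUB_range_neg.1 (by rwa [neg_neg])⟩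

variable {ι : Type w} [Preorder ι] [Countable ι]

theorem exists_isLUB_tail {f : ι → L0 C} {a : L0 C} (h : OConverges f a) (n : ι) :
    ∃ b, IsLUB (Set.range fun m : Set.Ici n => f m.1) b := by
  obtain ⟨l, r, -, -, hr, -, hf⟩ := h
  have : Nonempty (Set.Ici n) := ⟨⟨n, le_rfl⟩⟩
  refine exists_isLUB ⟨r n, ?_⟩
  rintro _ ⟨⟨m, hm⟩, rfl⟩
  exact (hf m).2.trans (hr hm)

theorem exists_isGLB_tail {f : ι → L0 C} {a : L0 C} (h : OConverges f a) (n : ι) :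
    ∃ b, IsGLB (Set.range fun m : Set.Ici n => f m.1) b := by
  obtain ⟨l, r, hl, -, -, -, hf⟩ := h
  have : Nonempty (Set.Ici n) := ⟨⟨n, le_rfl⟩⟩
  refine exists_isGLB ⟨l n, ?_⟩
  rintro _ ⟨⟨m, hm⟩, rfl⟩
  exact (hl hm).trans (hf m).1

end L0

namespace BooleanBundle

variable {Ω : Type u} [MeasurableSpace Ω] {lam : Measure Ω} [IsFiniteMeasure lam] {B : Ω → Type v}
  [∀ ω, CompleteBooleanAlgebra (B ω)] {E : BooleanBundle lam B}
  {ι : Type w} [Preorder ι] [Countable ι] [Nonempty ι] {F : ι → L0 E.Hat}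
  {f : ι → ∀ ω, L0 (B ω)}

/-- `(o)`-convergence in `L_0(∇̂, μ̂)` of a countable net implies `(o)`-convergence in almost every
fibre. -/
theorem oConverges_fibre (hF : ∀ i, IsIdentifiedWith (F i) (f i)) {G : L0 E.Hat}
    {g : ∀ ω, L0 (B ω)} (hG : IsIdentifiedWith G g) (h : OConverges F G) :
    ∀ᵐ ω ∂lam, OConverges (fun i => f i ω) (g ω) := by
  obtain ⟨L, R, hL, hLG, hR, hRG, hFLR⟩ := h
  choose l hl using fun i => exists_isIdentifiedWith (L i)
  choose r hr using fun i => exists_isIdentifiedWith (R i)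
  have h1 : ∀ᵐ ω ∂lam, ∀ i j, i ≤ j → l i ω ≤ l j ω := ae_all_iff.2 fun i => ae_all_iff.2 fun j =>
    eventually_imp_distrib_left.2 fun hij => ((hl i).le_iff (hl j)).1 (hL hij)
  have h2 : ∀ᵐ ω ∂lam, ∀ i j, i ≤ j → r j ω ≤ r i ω := ae_all_iff.2 fun i => ae_all_iff.2 fun j =>
    eventually_imp_distrib_left.2 fun hij => ((hr j).le_iff (hr i)).1 (hR hij)
  have h3 : ∀ᵐ ω ∂lam, ∀ i, l i ω ≤ f i ω :=
    ae_all_iff.2 fun i => ((hl i).le_iff (hF i)).1 (hFLR i).1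
  have h4 : ∀ᵐ ω ∂lam, ∀ i, f i ω ≤ r i ω :=
    ae_all_iff.2 fun i => ((hF i).le_iff (hr i)).1 (hFLR i).2
  filter_upwards [h1, h2, h3, h4, (isLUB_iff_of_isIdentifiedWith hl hG).1 hLG,
    (isGLB_iff_of_isIdentifiedWith hr hG).1 hRG] with ω h1 h2 h3 h4 h5 h6
  exact ⟨fun i => l i ω, fun i => r i ω, fun i j => h1 i j, h5, fun i j => h2 i j, h6,
    fun i => ⟨h3 i, h4 i⟩⟩

/-- `(o)`-convergence of a countable directed net in almost every fibre implies `(o)`-convergence in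
`L_0(∇̂, μ̂)`, with the infima and suprema of the tails as bounding nets. -/
theorem exists_oConverges_of_fibre [IsDirectedOrder ι] (hF : ∀ i, IsIdentifiedWith (F i) (f i))
    {g : ∀ ω, L0 (B ω)} (h : ∀ᵐ ω ∂lam, OConverges (fun i => f i ω) (g ω)) :
    ∃ G : L0 E.Hat, IsIdentifiedWith G g ∧ OConverges F G := by
  classical
  have hne : ∀ n : ι, Nonempty (Set.Ici n) := fun n => ⟨⟨n, le_rfl⟩⟩
  have hexr : ∀ n ω, ∃ b : L0 (B ω), OConverges (fun i => f i ω) (g ω) →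
      IsLUB (Set.range fun m : Set.Ici n => f m.1 ω) b := fun n ω => by
    by_cases hω : OConverges (fun i => f i ω) (g ω)
    · obtain ⟨b, hb⟩ := L0.exists_isLUB_tail hω n
      exact ⟨b, fun _ => hb⟩
    · exact ⟨g ω, fun h' => (hω h').elim⟩
  have hexl : ∀ n ω, ∃ b : L0 (B ω), OConverges (fun i => f i ω) (g ω) →
      IsGLB (Set.range fun m : Set.Ici n => f m.1 ω) b := fun n ω => by
    by_cases hω : OConverges (fun i => f i ω) (g ω)
    · obtain ⟨b, hb⟩ := L0.exists_isGLB_tail hω n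
      exact ⟨b, fun _ => hb⟩
    · exact ⟨g ω, fun h' => (hω h').elim⟩
  choose r hr using hexr
  choose l hl using hexl
  have hr' : ∀ n, ∀ᵐ ω ∂lam, IsLUB (Set.range fun m : Set.Ici n => f m.1 ω) (r n ω) :=
    fun n => h.mono fun ω hω => hr n ω hω
  have hl' : ∀ n, ∀ᵐ ω ∂lam, IsGLB (Set.range fun m : Set.Ici n => f m.1 ω) (l n ω) :=
    fun n => h.mono fun ω hω => hl n ω hω
  choose R hR using fun n => exists_isIdentifiedWith_of_isLUB (fun m : Set.Ici n => hF m.1) (hr' n)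
  choose L hL using fun n => exists_isIdentifiedWith_of_isGLB (fun m : Set.Ici n => hF m.1) (hl' n)
  have hRlub := fun n =>
    (isLUB_iff_of_isIdentifiedWith (fun m : Set.Ici n => hF m.1) (hR n)).2 (hr' n)
  have hLglb := fun n =>
    (isGLB_iff_of_isIdentifiedWith (fun m : Set.Ici n => hF m.1) (hL n)).2 (hl' n)
  have hlg : ∀ᵐ ω ∂lam, IsLUB (Set.range fun n => l n ω) (g ω) :=
    h.mono fun ω hω => hω.isLUB_of_isGLB_tails fun n => hl n ω hω
  have hrg : ∀ᵐ ω ∂lam, IsGLB (Set.range fun n => r n ω) (g ω) :=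
    h.mono fun ω hω => hω.isGLB_of_isLUB_tails fun n => hr n ω hω
  obtain ⟨G, hG⟩ := exists_isIdentifiedWith_of_isLUB hL hlg
  refine ⟨G, hG, L, R, fun i j hij => (hLglb j).2 ?_, (isLUB_iff_of_isIdentifiedWith hL hG).2 hlg,
    fun i j hij => (hRlub j).2 ?_, (isGLB_iff_of_isIdentifiedWith hR hG).2 hrg,
    fun i => ⟨(hLglb i).1 ⟨⟨i, le_rfl⟩, rfl⟩, (hRlub i).1 ⟨⟨i, le_rfl⟩, rfl⟩⟩⟩
  · rintro _ ⟨⟨m, hm⟩, rfl⟩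
    exact (hLglb i).1 ⟨⟨m, hij.trans hm⟩, rfl⟩
  · rintro _ ⟨⟨m, hm⟩, rfl⟩
    exact (hRlub i).1 ⟨⟨m, hij.trans hm⟩, rfl⟩

end BooleanBundle

theorem mainTheorem7 {Ω : Type u} [MeasurableSpace Ω] (lam : Measure Ω) [IsFiniteMeasure lam]
    {B : Ω → Type v} [∀ ω, CompleteBooleanAlgebra (B ω)] (E : BooleanBundle lam B) :
    (∀ F : L0 E.Hat, ∃ f : ∀ ω, L0 (B ω), BooleanBundle.IsIdentifiedWith F f) ∧
    ∀ (d : ℕ) (F : (Fin d → ℕ+) → L0 E.Hat) (f : (Fin d → ℕ+) → ∀ ω, L0 (B ω)),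
      (∀ n, BooleanBundle.IsIdentifiedWith (F n) (f n)) →
      (∀ (F' : L0 E.Hat) (f' : ∀ ω, L0 (B ω)), BooleanBundle.IsIdentifiedWith F' f' →
        OConverges F F' → ∀ᵐ ω ∂lam, OConverges (fun n => f n ω) (f' ω)) ∧
      (∀ g : ∀ ω, L0 (B ω), (∀ᵐ ω ∂lam, OConverges (fun n => f n ω) (g ω)) →
        ∃ G : L0 E.Hat, BooleanBundle.IsIdentifiedWith G g ∧ OConverges F G) :=
  ⟨fun F => BooleanBundle.exists_isIdentifiedWith F, fun _ _ _ hF =>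
    ⟨fun _ _ hG h => BooleanBundle.oConverges_fibre hF hG h,
      fun _ h => BooleanBundle.exists_oConverges_of_fibre hF h⟩⟩
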